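/- **Machine model.** A BSP machine has $p$ processors, each with $M$ words (real numbers) of main memory and a cache holding copies of at most $H$ of these words ($H\ge 3$). In a superstep each processor runs a list of local instructions (arithmetic on cached words, moving a word between main memory and cache, dropping a word from the cache); then words are exchanged between the main memories. If in superstep $s\in\{1,\dots,S\}$ processor $P$ performs $F_s^P$ floating point operations, sends and receives $W_s^P$ words in total, and moves $Q_s^P$ words between main memory and cache, then with $F=\sum_s\max_P F_s^P$, $W=\sum_s\max_P W_s^P$, $Q=\sum_s\max_P Q_s^P$ the BSP time is $T=\gamma F+\beta W+\nu Q+\alpha S$. The time parameters $\gamma,\beta,\nu,\alpha\ge 0$ satisfy $\gamma\le\beta$, $\nu\le\beta$ and $\nu\le\gamma\sqrt H$. **Setting.** Let $\delta\in[1/2,2/3]$, $p\ge 1$, and suppose that $q=p^{1-\delta}$ and $c=p^{2\delta-1}$ are integers. The processors form a $q\times q\times c$ grid $\Pi$. Let $m,n,k\ge p$, let $w$ be an integer with $1\le w\le q$, and put $z=wc$. Let $A$ be $m\times n$ and $B$ be $n\times k$. * Let $P^{(1)},P^{(2)}$ be permutation matrices and let $P^{(1)}AP^{(2)}=(A_{ij})_{1\le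 i,j\le q}$ be cut into blocks of consecutive rows and columns, where $A_{ij}$ is $m_i\times n_j$ with $m_i\le K\,m/p^{1-\delta}$ and $n_j\le K\,n/p^{1-\delta}$. For every $l\in\{1,\dots,c\}$, processor $\Pi[i,j,l]$ stores all of $A_{ij}$. * Each entry of $B$ is stored by one processor, and each processor stores at most $K\,nk/p$ entries of $B$; the layout is otherwise arbitrary. **Streaming-MM.** Cut $P^{(2)T}B=(B_{jh})_{1\le j\le q,\,1\le h\le z}$ into row blocks as given by the $n_j$ and evenly into $z$ blocks of consecutive columns, each of which is again cut evenly into $q$ pieces of $k/(zq)$ columns (up to rounding); let $C=AB$ and let $C_{ih}$ be the corresponding blocks of $P^{(1)}C$. First redistribute $B$ so that $\Pi[i,j,l]$ owns the $i$-th piece of the columns of $B_{jh}$ for each $h\in\{l,l+c,\dots,l+(w-1)c\}$. Then, in parallel for all $i,j,l$, and in sequence for these $h$: gather $B_{jh}$ on $\Pi[i,j,l]$; compute $\bar C_{ijh}=A_{ij}B_{jh}$ on $\Pi[i,j,l]$; reduce-scatter $C_{ih}=\sum_{j=1}^{q}\bar C_{ijh}$ so that $\Pi[i,j,l]$ owns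 the $j$-th piece of the columns of $C_{ih}$. In the end all these pieces of $P^{(1)}C$ are stored by their owners. **Claim.** For every $K$ there is a constant $c_0>0$, depending only on $K$, such that in the above setting, whenever $$M\ \ge\ c_0\left(\frac{mn}{p^{2(1-\delta)}}+\frac{mk+nk}{w\,p^{\delta}}\right),$$ the following holds, wherever in their main memories the processors store their parts of $A$ and $B$. 1. If $m_in_j\le H$ for all $i,j$ (so that in particular $H\ge mn/p^{2(1-\delta)}$), there is a BSP program that executes Streaming-MM for all $A$ and $B$, provided that each processor starts with its copy of $A_{ij}$ in cache, and for all $\gamma,\beta,\nu,\alpha$ as above it takes BSP time $$T\ \le\ c_0\left(\gamma\,\frac{mnk}{p}+\beta\,\frac{mk+nk}{p^{\delta}}+\alpha\,w\right).$$ 2. For all $H\ge 3$ and any initial contents of the caches, there is a BSP program that executes Streaming-MM for all $A$ and $B$ and for all $\gamma,\beta,\nu,\alpha$ as above takes BSP time $$T\ \le\ c_0\left(\gamma\,\frac{mnk}{p}+\beta\,\frac{mk+nk}{p^{\delta}}+\alpha\,w+\nu\,\frac{w\,mn}{p^{2(1-\delta)}}\right).$$ -/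

import Mathlib

/-! ### A bulk synchronous parallel machine with a two-level memory hierarchy -/

namespace BSP

/-- The state of one processor: `M` words of main memory, and a cache.  A cached word is a copy of
a word of main memory, so `cache a = some v` means that the cache holds the value `v` for the
address `a` (this value may differ from `mem a` until it is written back). -/
structure LocalState (M : ℕ) where
  mem : Fin M → ℝ
  cache : Fin M → Option ℝ

/-- The number of words that are held in the cache. -/
def LocalState.cached {M : ℕ} (s : LocalState M) : ℕ :=
  (Finset.univ.filter fun a => (s.cache a).isSome = true).card

/-- Local instructions.  Arithmetic acts on cached words only. -/
inductive Instr (M : ℕ) where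
  /-- copy a word from main memory to cache -/
  | load (a : Fin M)
  /-- copy a word from cache to main memory -/
  | store (a : Fin M)
  /-- drop a word from the cache without writing it back -/
  | evict (a : Fin M)
  /-- `d := 0` -/
  | zero (d : Fin M)
  /-- `d := a + b` -/
  | add (d a b : Fin M)
  /-- `d := a * b` -/
  | mul (d a b : Fin M)
  /-- `d := d + a * b` -/
  | muladd (d a b : Fin M)

/-- Floating point operations of an instruction. -/
def Instr.flops {M : ℕ} : Instr M → ℕ
  | .load _ => 0
  | .store _ => 0
  | .evict _ => 0
  | .zero _ => 1
  | .add _ _ _ => 1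
  | .mul _ _ _ => 1
  | .muladd _ _ _ => 2

/-- Words moved between main memory and cache by an instruction. -/
def Instr.traffic {M : ℕ} : Instr M → ℕ
  | .load _ => 1
  | .store _ => 1
  | .evict _ => 0
  | .zero _ => 0
  | .add _ _ _ => 0
  | .mul _ _ _ => 0
  | .muladd _ _ _ => 0

/-- Put the value `v` for the address `a` into the cache; this fails if more than `H` words would
then be cached. -/
noncomputable def LocalState.put {M : ℕ} (H : ℕ) (s : LocalState M) (a : Fin M) (v : ℝ) :
    Option (LocalState M) :=
  let s' : LocalState M := { s with cache := Function.update s.cache a (some v) }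
  if s'.cached ≤ H then some s' else none

/-- Effect of an instruction on a processor with `H` words of cache.  The result is `none` if an
operand is not in the cache or the cache would overflow. -/
noncomputable def Instr.run {M : ℕ} (H : ℕ) (s : LocalState M) : Instr M → Option (LocalState M)
  | .load a => s.put H a (s.mem a)
  | .store a => (s.cache a).bind fun v => some { s with mem := Function.update s.mem a v }
  | .evict a => some { s with cache := Function.update s.cache a none }
  | .zero d => s.put H d 0
  | .add d a b => (s.cache a).bind fun u => (s.cache b).bind fun v => s.put H d (u + v)
  | .mul d a b => (s.cache a).bind fun u => (s.cache b).bind fun v => s.put H d (u * v)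
  | .muladd d a b => (s.cache d).bind fun t => (s.cache a).bind fun u => (s.cache b).bind fun v =>
      s.put H d (t + u * v)

/-- Run a list of instructions in order. -/
noncomputable def runInstrs {M : ℕ} (H : ℕ) : List (Instr M) → LocalState M → Option (LocalState M)
  | [], s => some s
  | i :: l, s => (i.run H s).bind (runInstrs H l)

/-- A superstep of processors indexed by `ι`: a list of local instructions for each processor,
followed by a global exchange of words between main memories.  `recv P a = some (R, b)` means that
processor `P` receives at its address `a` the word that processor `R` has at address `b`. -/
structure Superstep (ι : Type) (M : ℕ) where
  instrs : ι → List (Instr M)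
  recv : ι → Fin M → Option (ι × Fin M)

/-- The exchange of words at the end of a superstep.  All words are read before any is written; a
cached copy of an overwritten word is invalidated. -/
def deliver {ι : Type} {M : ℕ} (recv : ι → Fin M → Option (ι × Fin M))
    (σ : ι → LocalState M) : ι → LocalState M := fun P =>
  { mem := fun a => match recv P a with
      | none => (σ P).mem a
      | some (R, b) => (σ R).mem b
    cache := fun a => match recv P a with
      | none => (σ P).cache a
      | some _ => none }

/-- The superstep `s` leads from the configuration `σ` to the configuration `τ`. -/
def Superstep.Exec {ι : Type} {M : ℕ} (H : ℕ) (s : Superstep ι M) (σ τ : ι → LocalState M) : Prop :=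
  ∃ ρ : ι → LocalState M, (∀ P, runInstrs H (s.instrs P) (σ P) = some (ρ P)) ∧
    τ = deliver s.recv ρ

/-- Floating point operations of processor `P` in a superstep. -/
def Superstep.flops {ι : Type} {M : ℕ} (s : Superstep ι M) (P : ι) : ℕ :=
  ((s.instrs P).map Instr.flops).sum

/-- Words moved between main memory and cache by processor `P` in a superstep. -/
def Superstep.traffic {ι : Type} {M : ℕ} (s : Superstep ι M) (P : ι) : ℕ :=
  ((s.instrs P).map Instr.traffic).sum

/-- Words received plus words sent by processor `P` in a superstep. -/
def Superstep.words {ι : Type} [Fintype ι] [DecidableEq ι] {M : ℕ} (s : Superstep ι M) (P : ι) :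
    ℕ :=
  (Finset.univ.filter fun a : Fin M => (s.recv P a).isSome = true).card +
  (Finset.univ.filter fun d : ι × Fin M => (s.recv d.1 d.2).map Prod.fst = some P).card

/-- A program: the supersteps `step 0, …, step (S - 1)`. -/
structure Program (ι : Type) (M : ℕ) where
  S : ℕ
  step : ℕ → Superstep ι M

/-- Computation cost `F`. -/
def Program.F {ι : Type} [Fintype ι] {M : ℕ} (prog : Program ι M) : ℕ :=
  ∑ t ∈ Finset.range prog.S, Finset.univ.sup fun P => (prog.step t).flops P

/-- Horizontal communication cost `W`. -/
def Program.W {ι : Type} [Fintype ι] [DecidableEq ι] {M : ℕ} (prog : Program ι M) : ℕ :=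
  ∑ t ∈ Finset.range prog.S, Finset.univ.sup fun P => (prog.step t).words P

/-- Vertical communication cost `Q`. -/
def Program.Q {ι : Type} [Fintype ι] {M : ℕ} (prog : Program ι M) : ℕ :=
  ∑ t ∈ Finset.range prog.S, Finset.univ.sup fun P => (prog.step t).traffic P

/-- BSP execution time `γ F + β W + ν Q + α S`. -/
def Program.time {ι : Type} [Fintype ι] [DecidableEq ι] {M : ℕ} (prog : Program ι M)
    (γ β ν α : ℝ) : ℝ :=
  γ * prog.F + β * prog.W + ν * prog.Q + α * prog.S

/-- `σ 0, …, σ S` are the successive configurations of an execution of `prog` on processors with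
`H` words of cache. -/
def Program.IsRun {ι : Type} {M : ℕ} (prog : Program ι M) (H : ℕ)
    (σ : ℕ → ι → LocalState M) : Prop :=
  ∀ t < prog.S, (prog.step t).Exec H (σ t) (σ (t + 1))

end BSP

/-! ### The streaming matrix multiplication algorithm -/

namespace StreamingMM

/-- The processor grid; `(i, j, l)` is the processor in row `i` and column `j` of layer `l`. -/
abbrev Proc (q c : ℕ) : Type := Fin q × Fin q × Fin c

/-- The initial layout, on processors with `M` words of memory, of an `m × n` matrix `A` and an
`n × k` matrix `B`.
The permutations `P₁`, `P₂` define the matrix `P₁ A P₂`; its rows and columns are cut into `q`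
consecutive blocks, and `rowBlk x` (`colBlk y`) is the block that contains row `x` (column `y`).
`owner y x` is the processor that owns the entry `(y, x)` of `B`.
Finally `loc P` gives the addresses at which processor `P` stores the entries of `P₁ A P₂` and of
`B` that it owns. -/
structure Layout (m n k q c M : ℕ) where
  P₁ : Equiv.Perm (Fin m)
  P₂ : Equiv.Perm (Fin n)
  rowBlk : Fin m → Fin q
  colBlk : Fin n → Fin q
  rowBlk_mono : Monotone rowBlk
  colBlk_mono : Monotone colBlk
  owner : Fin n → Fin k → Proc q c
  loc : Proc q c → (Fin m × Fin n) ⊕ (Fin n × Fin k) → Fin M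
  /-- Distinct entries are stored at distinct addresses.  Every layer owns a copy of `A`. -/
  loc_inj : ∀ P : Proc q c, Set.InjOn (loc P)
    {e | Sum.elim (fun a : Fin m × Fin n => rowBlk a.1 = P.1 ∧ colBlk a.2 = P.2.1)
      (fun b : Fin n × Fin k => owner b.1 b.2 = P) e}

namespace Layout

variable {m n k q c M : ℕ}

/-- Number of rows in the `i`-th block of rows of `P₁ A P₂`. -/
def rows (L : Layout m n k q c M) (i : Fin q) : ℕ :=
  (Finset.univ.filter fun x => L.rowBlk x = i).card

/-- Number of columns in the `j`-th block of columns of `P₁ A P₂`. -/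
def cols (L : Layout m n k q c M) (j : Fin q) : ℕ :=
  (Finset.univ.filter fun y => L.colBlk y = j).card

/-- Number of entries of `B` owned by processor `P`. -/
def owned (L : Layout m n k q c M) (P : Proc q c) : ℕ :=
  (Finset.univ.filter fun e : Fin n × Fin k => L.owner e.1 e.2 = P).card

/-- The matrix `P₁ A P₂`. -/
noncomputable def permA (L : Layout m n k q c M) (A : Matrix (Fin m) (Fin n) ℝ) :
    Matrix (Fin m) (Fin n) ℝ :=
  L.P₁.permMatrix ℝ * A * L.P₂.permMatrix ℝ

/-- The matrix `P₂ᵀ B`. -/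
noncomputable def permB (L : Layout m n k q c M) (B : Matrix (Fin n) (Fin k) ℝ) :
    Matrix (Fin n) (Fin k) ℝ :=
  (L.P₂.permMatrix ℝ).transpose * B

/-- The matrix `P₁ C` for `C = A B`. -/
noncomputable def permC (L : Layout m n k q c M) (A : Matrix (Fin m) (Fin n) ℝ)
    (B : Matrix (Fin n) (Fin k) ℝ) : Matrix (Fin m) (Fin k) ℝ :=
  L.P₁.permMatrix ℝ * (A * B)

/-- The entry in row `r` and column `x` of the product of the blocks of `P₁ A P₂` and `P₂ᵀ B` that
belong to the `j`-th block of inner indices. -/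
noncomputable def partialC (L : Layout m n k q c M) (A : Matrix (Fin m) (Fin n) ℝ)
    (B : Matrix (Fin n) (Fin k) ℝ) (j : Fin q) (r : Fin m) (x : Fin k) : ℝ :=
  ∑ y ∈ Finset.univ.filter fun y => L.colBlk y = j, L.permA A r y * L.permB B y x

/-- A start configuration: the owned entries of `P₁ A P₂` and of `B` are in main memory, the other
words of main memory are arbitrary, and so is the cache, up to its capacity. -/
def IsStart (L : Layout m n k q c M) (H : ℕ) (A : Matrix (Fin m) (Fin n) ℝ)
    (B : Matrix (Fin n) (Fin k) ℝ) (σ : Proc q c → BSP.LocalState M) : Prop :=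
  ∀ P : Proc q c, (σ P).cached ≤ H ∧
    (∀ x y, L.rowBlk x = P.1 → L.colBlk y = P.2.1 →
      (σ P).mem (L.loc P (Sum.inl (x, y))) = L.permA A x y) ∧
    (∀ y x, L.owner y x = P → (σ P).mem (L.loc P (Sum.inr (y, x))) = B y x)

/-- Each processor has its block of `P₁ A P₂` in cache. -/
def ACached (L : Layout m n k q c M) (A : Matrix (Fin m) (Fin n) ℝ)
    (σ : Proc q c → BSP.LocalState M) : Prop :=
  ∀ P : Proc q c, ∀ x y, L.rowBlk x = P.1 → L.colBlk y = P.2.1 →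
    (σ P).cache (L.loc P (Sum.inl (x, y))) = some (L.permA A x y)

end Layout

/-- The `k` columns of `B` are cut evenly into `w * c * q` consecutive pieces; this is the piece
(counted from `0`) that contains column `x`.  It consists of `k / (w * c * q)` columns if this
quotient is an integer, and of that number rounded up or down otherwise. -/
def piece (q c w : ℕ) {k : ℕ} (x : Fin k) : ℕ := x.val * (w * c * q) / k

/-- Column `x` lies in the column block `h` (counted from `0`) among `w * c` blocks. -/
def InBlock (q c w : ℕ) {k : ℕ} (h : ℕ) (x : Fin k) : Prop := piece q c w x / q = h

/-- Column `x` lies in the `i`-th of the `q` pieces of the column block `h`. -/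
def InPiece (q c w : ℕ) {k : ℕ} (h : ℕ) (i : Fin q) (x : Fin k) : Prop :=
  InBlock q c w h x ∧ piece q c w x % q = i.val

/-- When (after how many supersteps) and where (at which addresses) the stages of the algorithm
leave their results.  The loop index `t` runs from `0` to `w - 1`. -/
structure Schedule (m n k q c M : ℕ) where
  redist : ℕ
  gather : ℕ → ℕ
  compute : ℕ → ℕ
  reduce : ℕ → ℕ
  locRedist : Proc q c → Fin n → Fin k → Fin M
  locGather : ℕ → Proc q c → Fin n → Fin k → Fin M
  locCompute : ℕ → Proc q c → Fin m → Fin k → Fin M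
  locC : Proc q c → Fin m → Fin k → Fin M

/-- The stages come in the order of the algorithm, within `S` supersteps. -/
structure Schedule.Ordered {m n k q c M : ℕ} (s : Schedule m n k q c M) (w S : ℕ) : Prop where
  redist_lt : ∀ t < w, s.redist < s.gather t
  gather_lt : ∀ t < w, s.gather t < s.compute t
  compute_lt : ∀ t < w, s.compute t < s.reduce t
  reduce_le : ∀ t, t + 1 < w → s.reduce t ≤ s.gather (t + 1)
  le_end : ∀ t < w, s.reduce t ≤ S

/-- `σ 0, …, σ S` are the configurations of an execution of streaming matrix multiplication for
the inputs `A` and `B`.  In iteration `t` layer `l` treats the column block `l + t * c`. -/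
structure Stages {m n k q c M : ℕ} (L : Layout m n k q c M) (s : Schedule m n k q c M) (w S : ℕ)
    (A : Matrix (Fin m) (Fin n) ℝ) (B : Matrix (Fin n) (Fin k) ℝ)
    (σ : ℕ → Proc q c → BSP.LocalState M) : Prop where
  /-- After the redistribution, processor `(i, j, l)` has the `i`-th piece of the columns of the
  block of `P₂ᵀ B` in block row `j` and block column `h`, for all `h = l + t * c`. -/
  redist : ∀ (i j : Fin q) (l : Fin c), ∀ t < w, ∀ y x, L.colBlk y = j →
    InPiece q c w (l + t * c) i x →
    (σ s.redist (i, j, l)).mem (s.locRedist (i, j, l) y x) = L.permB B y x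
  /-- The whole block of `P₂ᵀ B` is gathered. -/
  gather : ∀ (i j : Fin q) (l : Fin c), ∀ t < w, ∀ y x, L.colBlk y = j →
    InBlock q c w (l + t * c) x →
    (σ (s.gather t) (i, j, l)).mem (s.locGather t (i, j, l) y x) = L.permB B y x
  /-- It is multiplied by the local block of `P₁ A P₂`. -/
  compute : ∀ (i j : Fin q) (l : Fin c), ∀ t < w, ∀ r x, L.rowBlk r = i →
    InBlock q c w (l + t * c) x →
    (σ (s.compute t) (i, j, l)).mem (s.locCompute t (i, j, l) r x) = L.partialC A B j r x
  /-- The products are summed over `j`, and processor `(i, j, l)` gets the `j`-th piece of the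
  columns of the sum. -/
  reduce : ∀ (i j : Fin q) (l : Fin c), ∀ t < w, ∀ r x, L.rowBlk r = i →
    InPiece q c w (l + t * c) j x →
    (σ (s.reduce t) (i, j, l)).mem (s.locC (i, j, l) r x) = L.permC A B r x
  /-- In the end all these pieces of `P₁ C` are present. -/
  final : ∀ (i j : Fin q) (l : Fin c), ∀ t < w, ∀ r x, L.rowBlk r = i →
    InPiece q c w (l + t * c) j x →
    (σ S (i, j, l)).mem (s.locC (i, j, l) r x) = L.permC A B r x

/-- The program `prog` executes streaming matrix multiplication with `w` iterations from the layout
`L`, for all `A` and `B` and all start configurations in which (if `warm` holds) the blocks of `A`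
are in cache. -/
def Executes {m n k q c M : ℕ} (prog : BSP.Program (Proc q c) M) (L : Layout m n k q c M)
    (H w : ℕ) (warm : Prop) : Prop :=
  ∃ s : Schedule m n k q c M, s.Ordered w prog.S ∧
    ∀ (A : Matrix (Fin m) (Fin n) ℝ) (B : Matrix (Fin n) (Fin k) ℝ)
      (σ₀ : Proc q c → BSP.LocalState M), L.IsStart H A B σ₀ → (warm → L.ACached A σ₀) →
      ∃ σ : ℕ → Proc q c → BSP.LocalState M,
        σ 0 = σ₀ ∧ prog.IsRun H σ ∧ Stages L s w prog.S A B σ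

end StreamingMM

/-! The program has `3 * w + 1` supersteps. One redistributes `B` and evicts all cached words that
are not to be kept. Each iteration then has three: gather a block of `B`; multiply it by the local
block of `A` and send the pieces of the product to their owners; add up the received pieces. With q
c = p^δ and q² c = p, each superstep moves O((mk + nk) / (w q c)) words between processors and
spends O(mnk / (w q² c)) flops on block products, so O(w) supersteps give the main terms. The
condition w ≤ q is used twice: it makes the redistribution fit into the same budget per superstep,
and it gives w c q ≤ p ≤ k, so that rounding the sizes of blocks and pieces up costs at most a
factor 2. Flops for zeroing and summing, and traffic proportional to entries of `B` and `C`, are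
charged to the horizontal communication through γ ≤ β and ν ≤ β.

The delicate resource is the cache. If it starts with the block of `A`, this block may fill it,
leaving no room for an operand. Therefore all but three rows of the block are kept (`exists_kept`):
the freed space suffices to work in, and the other rows are processed by 1 × 1 tiles with traffic
proportional to the gathered block (`trafficOf_multiply_kept_le`). If nothing is cached, tiles of
side s = Θ(√H) are used. Then each iteration reads `A` once, which gives the term ν w mn / q², and
the remaining tiling traffic O(mnk / (w q² c s)) is absorbed by the flops because ν ≤ γ √H
(`trafficOf_multiply_empty_le`, `sqrt_le_four_mul_sqrt`).

Correctness of local computations rests on `Adds`, a composable specification of instruction lists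
that only add to main memory. `runInstrs_multiply` and `runInstrs_sumUp` follow from it. The buffers
of all stages fit disjointly into memory by `Addresses.nonempty`. The three kinds of supersteps in
an iteration pass the invariants `Ready`, `Gathered` and `Computed` on to each other, and
`Addresses.executes` assembles the run. -/

namespace BSP

/-! ### Instruction lists: costs, cache contents, elementary routines. -/

variable {M : ℕ} {α : Type*}

/-- The instructions `body x` for all `x ∈ S`, in some order. -/
noncomputable def forEach (S : Finset α) (body : α → List (Instr M)) : List (Instr M) :=
  S.toList.flatMap body

/-- Floating point operations of a list of instructions. -/
def flopsOf (l : List (Instr M)) : ℕ := (l.map Instr.flops).sum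

/-- Words moved between main memory and cache by a list of instructions. -/
def trafficOf (l : List (Instr M)) : ℕ := (l.map Instr.traffic).sum

@[simp] theorem flopsOf_nil : flopsOf ([] : List (Instr M)) = 0 := rfl

@[simp] theorem trafficOf_nil : trafficOf ([] : List (Instr M)) = 0 := rfl

@[simp] theorem flopsOf_cons (i : Instr M) (l : List (Instr M)) :
    flopsOf (i :: l) = i.flops + flopsOf l := by
  simp [flopsOf]

@[simp] theorem trafficOf_cons (i : Instr M) (l : List (Instr M)) :
    trafficOf (i :: l) = i.traffic + trafficOf l := by
  simp [trafficOf]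

@[simp] theorem flopsOf_append (l₁ l₂ : List (Instr M)) :
    flopsOf (l₁ ++ l₂) = flopsOf l₁ + flopsOf l₂ := by
  simp [flopsOf]

@[simp] theorem trafficOf_append (l₁ l₂ : List (Instr M)) :
    trafficOf (l₁ ++ l₂) = trafficOf l₁ + trafficOf l₂ := by
  simp [trafficOf]

@[simp] theorem flopsOf_forEach (S : Finset α) (body : α → List (Instr M)) :
    flopsOf (forEach S body) = ∑ x ∈ S, flopsOf (body x) := by
  rw [← Finset.sum_map_toList S, forEach]
  induction S.toList with
  | nil => rfl
  | cons x l ih => simp [ih]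

@[simp] theorem trafficOf_forEach (S : Finset α) (body : α → List (Instr M)) :
    trafficOf (forEach S body) = ∑ x ∈ S, trafficOf (body x) := by
  rw [← Finset.sum_map_toList S, forEach]
  induction S.toList with
  | nil => rfl
  | cons x l ih => simp [ih]

theorem runInstrs_append (H : ℕ) (l₁ l₂ : List (Instr M)) (s : LocalState M) :
    runInstrs H (l₁ ++ l₂) s = (runInstrs H l₁ s).bind (runInstrs H l₂) := by
  induction l₁ generalizing s with
  | nil => rfl
  | cons i l ih =>
    simp only [List.cons_append, runInstrs, Option.bind_assoc]
    congr 1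
    funext s'
    exact ih s'

theorem runInstrs_append_of {H : ℕ} {l₁ l₂ : List (Instr M)} {s s' s'' : LocalState M}
    (h₁ : runInstrs H l₁ s = some s') (h₂ : runInstrs H l₂ s' = some s'') :
    runInstrs H (l₁ ++ l₂) s = some s'' := by
  rw [runInstrs_append, h₁, Option.bind_some, h₂]

theorem runInstrs_cons_of {H : ℕ} {i : Instr M} {l : List (Instr M)} {s s' s'' : LocalState M}
    (h₁ : i.run H s = some s') (h₂ : runInstrs H l s' = some s'') :
    runInstrs H (i :: l) s = some s'' := by
  rw [runInstrs, h₁, Option.bind_some, h₂]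

/-- The addresses held in a cache. -/
def supp (κ : Fin M → Option ℝ) : Finset (Fin M) := Finset.univ.filter fun a => (κ a).isSome = true

theorem card_supp_update_le (κ : Fin M → Option ℝ) (a : Fin M) (v : Option ℝ) :
    (supp (Function.update κ a v)).card ≤ (supp κ).card + 1 := by
  refine (Finset.card_le_card (t := insert a (supp κ)) fun b hb => ?_).trans
    (Finset.card_insert_le _ _)
  by_cases hab : b = a
  · simp [hab]
  · simpa [supp, hab] using hb

theorem supp_update_update (κ : Fin M → Option ℝ) (a : Fin M) (u v : ℝ) :
    supp (Function.update (Function.update κ a (some u)) a (some v)) =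
      supp (Function.update κ a (some u)) := by
  ext b
  by_cases hab : b = a <;> simp [supp, hab]

theorem put_eq {H : ℕ} {μ : Fin M → ℝ} {κ : Fin M → Option ℝ} {a : Fin M} {v : ℝ}
    (h : (supp (Function.update κ a (some v))).card ≤ H) :
    LocalState.put H ⟨μ, κ⟩ a v = some ⟨μ, Function.update κ a (some v)⟩ := by
  have h' : LocalState.cached (⟨μ, Function.update κ a (some v)⟩ : LocalState M) ≤ H := h
  simp [LocalState.put, h']

/-- The cache `κ` with copies of the words of `μ` at the addresses in `S` added. -/
def overlay (κ : Fin M → Option ℝ) (S : Finset (Fin M)) (μ : Fin M → ℝ) : Fin M → Option ℝ :=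
  fun a => if a ∈ S then some (μ a) else κ a

theorem card_supp_overlay_le (κ : Fin M → Option ℝ) (S : Finset (Fin M)) (μ : Fin M → ℝ) :
    (supp (overlay κ S μ)).card ≤ (supp κ).card + S.card := by
  refine (Finset.card_le_card (t := supp κ ∪ S) fun b hb => ?_).trans (Finset.card_union_le _ _)
  by_cases hab : b ∈ S
  · simp [hab]
  · have hb' := (Finset.mem_filter.1 hb).2
    simp only [overlay, hab, if_false] at hb'
    simp [supp, hb']

/-- Load all words of `S`. -/
noncomputable def loads (S : Finset (Fin M)) : List (Instr M) := forEach S fun a => [Instr.load a]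

/-- Evict all words of `S`. -/
noncomputable def evicts (S : Finset (Fin M)) : List (Instr M) := forEach S fun a => [Instr.evict a]

@[simp] theorem flopsOf_loads (S : Finset (Fin M)) : flopsOf (loads S) = 0 := by
  simp [loads, Instr.flops]

@[simp] theorem flopsOf_evicts (S : Finset (Fin M)) : flopsOf (evicts S) = 0 := by
  simp [evicts, Instr.flops]

@[simp] theorem trafficOf_loads (S : Finset (Fin M)) : trafficOf (loads S) = S.card := by
  simp [loads, Instr.traffic]

@[simp] theorem trafficOf_evicts (S : Finset (Fin M)) : trafficOf (evicts S) = 0 := by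
  simp [evicts, Instr.traffic]

theorem runInstrs_loads {H : ℕ} (S : Finset (Fin M)) (μ : Fin M → ℝ) (κ : Fin M → Option ℝ)
    (h : (supp κ).card + S.card ≤ H) :
    runInstrs H (loads S) ⟨μ, κ⟩ = some ⟨μ, overlay κ S μ⟩ := by
  have key : ∀ (l : List (Fin M)) (κ : Fin M → Option ℝ), (supp κ).card + l.length ≤ H →
      runInstrs H (l.flatMap fun a => [Instr.load a]) ⟨μ, κ⟩ =
        some ⟨μ, fun a => if a ∈ l then some (μ a) else κ a⟩ := by
    intro l
    induction l with
    | nil => intro κ _; simp [runInstrs]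
    | cons a l ih =>
      intro κ hκ
      have h1 := card_supp_update_le κ a (some (μ a))
      simp only [List.length_cons] at hκ
      refine runInstrs_cons_of (s' := ⟨μ, Function.update κ a (some (μ a))⟩)
        (put_eq (h1.trans (by omega))) ?_
      refine (ih _ (by omega)).trans ?_
      congr 2
      funext b
      by_cases hb : b ∈ l <;> by_cases hab : b = a <;> simp [hb, hab]
  have h' := key S.toList κ (by simpa using h)
  simp only [Finset.mem_toList] at h'
  exact h'

theorem runInstrs_evicts {H : ℕ} (S : Finset (Fin M)) (μ : Fin M → ℝ) (κ : Fin M → Option ℝ) :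
    runInstrs H (evicts S) ⟨μ, κ⟩ = some ⟨μ, fun a => if a ∈ S then none else κ a⟩ := by
  have key : ∀ (l : List (Fin M)) (κ : Fin M → Option ℝ),
      runInstrs H (l.flatMap fun a => [Instr.evict a]) ⟨μ, κ⟩ =
        some ⟨μ, fun a => if a ∈ l then none else κ a⟩ := by
    intro l
    induction l with
    | nil => intro κ; simp [runInstrs]
    | cons a l ih =>
      intro κ
      refine runInstrs_cons_of (s' := ⟨μ, Function.update κ a none⟩) rfl ?_
      refine (ih _).trans ?_
      congr 2
      funext b
      by_cases hb : b ∈ l <;> by_cases hab : b = a <;> simp [hb, hab]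
  simpa [evicts, forEach] using key S.toList κ

/-- Set the words of `S` to zero. -/
noncomputable def zeros (S : Finset (Fin M)) : List (Instr M) :=
  forEach S fun a => [Instr.zero a, Instr.store a, Instr.evict a]

@[simp] theorem flopsOf_zeros (S : Finset (Fin M)) : flopsOf (zeros S) = S.card := by
  simp [zeros, Instr.flops]

@[simp] theorem trafficOf_zeros (S : Finset (Fin M)) : trafficOf (zeros S) = S.card := by
  simp [zeros, Instr.traffic]

/-- One free cache word suffices, as each word is evicted before the next is treated. The eviction
restores `κ` only because the words of `S` were not cached before. -/
theorem runInstrs_zeros {H : ℕ} (S : Finset (Fin M)) (μ : Fin M → ℝ) (κ : Fin M → Option ℝ)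
    (h : (supp κ).card + 1 ≤ H) (hκ : ∀ a ∈ S, κ a = none) :
    runInstrs H (zeros S) ⟨μ, κ⟩ = some ⟨fun a => if a ∈ S then 0 else μ a, κ⟩ := by
  have key : ∀ (l : List (Fin M)) (μ : Fin M → ℝ), (∀ a ∈ l, κ a = none) →
      runInstrs H (l.flatMap fun a => [Instr.zero a, Instr.store a, Instr.evict a]) ⟨μ, κ⟩ =
        some ⟨fun a => if a ∈ l then 0 else μ a, κ⟩ := by
    intro l
    induction l with
    | nil => intro μ _; simp [runInstrs]
    | cons a l ih =>
      intro μ hl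
      have h1 := card_supp_update_le κ a (some 0)
      refine runInstrs_cons_of (s' := ⟨μ, Function.update κ a (some 0)⟩) (put_eq (by omega)) ?_
      refine runInstrs_cons_of
        (s' := ⟨Function.update μ a 0, Function.update κ a (some 0)⟩) ?_ ?_
      · simp [Instr.run]
      refine runInstrs_cons_of (s' := ⟨Function.update μ a 0, κ⟩) ?_ ?_
      -- Rewriting `none` as `κ a` turns the eviction into a trivial update of `κ`.
      · simp [Instr.run, ← hl a (by simp)]
      refine (ih _ fun b hb => hl b (by simp [hb])).trans ?_
      congr 2
      funext b
      by_cases hb : b ∈ l <;> by_cases hab : b = a <;> simp [hb, hab]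
  simpa [zeros, forEach] using key S.toList μ (by simpa using hκ)

/-! ### A calculus of additive updates of main memory. -/

/-- With cache `κ` before and after, and as long as main memory agrees with `μ₀` on `Z`, the
instructions `l` add `Δ` to main memory, where `Δ` vanishes on `Z`. -/
structure Adds (H : ℕ) (κ : Fin M → Option ℝ) (Z : Set (Fin M)) (μ₀ : Fin M → ℝ)
    (l : List (Instr M)) (Δ : Fin M → ℝ) : Prop where
  zero : ∀ a ∈ Z, Δ a = 0
  run : ∀ μ, Set.EqOn μ μ₀ Z → runInstrs H l ⟨μ, κ⟩ = some ⟨μ + Δ, κ⟩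

namespace Adds

variable {H : ℕ} {κ : Fin M → Option ℝ} {Z : Set (Fin M)} {μ₀ : Fin M → ℝ}

theorem nil : Adds H κ Z μ₀ [] 0 := ⟨fun _ _ => rfl, fun μ _ => by simp [runInstrs]⟩

/-- The set `Z` acts as read-only memory: since `Δ₁` vanishes there, the second list still finds the
values of `μ₀` on which its effect depends. -/
theorem append {l₁ l₂ : List (Instr M)} {Δ₁ Δ₂ : Fin M → ℝ} (h₁ : Adds H κ Z μ₀ l₁ Δ₁)
    (h₂ : Adds H κ Z μ₀ l₂ Δ₂) : Adds H κ Z μ₀ (l₁ ++ l₂) (Δ₁ + Δ₂) := by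
  refine ⟨fun a ha => by simp [h₁.zero a ha, h₂.zero a ha], fun μ hμ => ?_⟩
  refine runInstrs_append_of (h₁.run μ hμ) ?_
  rw [h₂.run, add_assoc]
  intro a ha
  simp [h₁.zero a ha, hμ ha]

/-- Additions commute, so the unspecified order in which `forEach` enumerates `S` does not matter.
-/
theorem forEach {S : Finset α} {body : α → List (Instr M)} {Δ : α → Fin M → ℝ}
    (h : ∀ x ∈ S, Adds H κ Z μ₀ (body x) (Δ x)) :
    Adds H κ Z μ₀ (forEach S body) (∑ x ∈ S, Δ x) := by
  rw [← Finset.sum_map_toList S, BSP.forEach]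
  have key : ∀ l : List α, (∀ x ∈ l, x ∈ S) →
      Adds H κ Z μ₀ (l.flatMap body) (l.map Δ).sum := by
    intro l
    induction l with
    | nil => intro _; exact nil
    | cons x l ih =>
      intro hl
      simp only [List.flatMap_cons, List.map_cons, List.sum_cons]
      exact (h x (hl x (by simp))).append (ih fun y hy => hl y (by simp [hy]))
  exact key _ (by simp)

/-- Words of `Z` can be loaded before, and evicted after. -/
theorem wrap {S : Finset (Fin M)} {l : List (Instr M)} {Δ : Fin M → ℝ}
    (h : Adds H (overlay κ S μ₀) Z μ₀ l Δ) (hS : ∀ a ∈ S, a ∈ Z) (hκ : ∀ a ∈ S, κ a = none)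
    (hc : (supp κ).card + S.card ≤ H) :
    Adds H κ Z μ₀ (loads S ++ l ++ evicts S) Δ := by
  refine ⟨h.zero, fun μ hμ => ?_⟩
  have h1 := runInstrs_loads S μ κ hc
  -- The loaded words belong to `Z`, so the cached values do not depend on the current memory `μ`.
  have e : overlay κ S μ = overlay κ S μ₀ := by
    funext a
    by_cases ha : a ∈ S
    · simp [overlay, ha, hμ (hS a ha)]
    · simp [overlay, ha]
  rw [e] at h1
  refine runInstrs_append_of (runInstrs_append_of h1 (h.run μ hμ)) ?_
  rw [runInstrs_evicts]
  congr 2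
  funext a
  by_cases ha : a ∈ S
  · simp [ha, hκ a ha]
  · simp [overlay, ha]

end Adds

/-- Load the word `d`, execute `l`, and write `d` back. -/
def update (d : Fin M) (l : List (Instr M)) : List (Instr M) :=
  Instr.load d :: (l ++ [Instr.store d, Instr.evict d])

@[simp] theorem flopsOf_update (d : Fin M) (l : List (Instr M)) :
    flopsOf (update d l) = flopsOf l := by
  simp [update, Instr.flops]

@[simp] theorem trafficOf_update (d : Fin M) (l : List (Instr M)) :
    trafficOf (update d l) = trafficOf l + 2 := by
  simp [update, Instr.traffic]
  omega

/-- The running total lives only in the cached copy of `d`; main memory stays fixed until the single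
write-back. This is why a whole sum costs two words of traffic for its target. -/
theorem Adds.update {H : ℕ} {κ : Fin M → Option ℝ} {Z : Set (Fin M)} {μ₀ : Fin M → ℝ}
    {d : Fin M} {S : Finset α} {body : α → List (Instr M)} {v : α → ℝ} (hdZ : d ∉ Z)
    (hd : κ d = none) (hc : (supp κ).card + 1 ≤ H)
    (h : ∀ y ∈ S, ∀ μ t, Set.EqOn μ μ₀ Z →
      runInstrs H (body y) ⟨μ, Function.update κ d (some t)⟩ =
        some ⟨μ, Function.update κ d (some (t + v y))⟩) :
    Adds H κ Z μ₀ (update d (BSP.forEach S body)) (Pi.single d (∑ y ∈ S, v y)) := by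
  constructor
  · intro a ha
    have : a ≠ d := fun e => hdZ (e ▸ ha)
    simp [this]
  intro μ hμ
  have key : ∀ (l : List α) (t : ℝ), (∀ y ∈ l, y ∈ S) →
      runInstrs H (l.flatMap body) ⟨μ, Function.update κ d (some t)⟩ =
        some ⟨μ, Function.update κ d (some (t + (l.map v).sum))⟩ := by
    intro l
    induction l with
    | nil => intro t _; simp [runInstrs]
    | cons y l ih =>
      intro t hl
      simp only [List.flatMap_cons, List.map_cons, List.sum_cons]
      refine runInstrs_append_of (h y (hl y (by simp)) μ t hμ) ?_
      rw [ih _ fun x hx => hl x (by simp [hx]), add_assoc]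
  have h1 := card_supp_update_le κ d (some (μ d))
  refine runInstrs_cons_of (s' := ⟨μ, Function.update κ d (some (μ d))⟩)
    (put_eq (h1.trans hc)) ?_
  refine runInstrs_append_of (key S.toList (μ d) (by simp)) ?_
  rw [Finset.sum_map_toList]
  refine runInstrs_cons_of (s' := ⟨Function.update μ d (μ d + ∑ y ∈ S, v y),
    Function.update κ d (some (μ d + ∑ y ∈ S, v y))⟩) (by simp [Instr.run]) ?_
  refine runInstrs_cons_of (s' := ⟨μ + Pi.single d (∑ y ∈ S, v y), κ⟩) ?_ rfl
  simp only [Instr.run, Function.update_idem, ← hd, Function.update_eq_self, Option.some.injEq,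
    LocalState.mk.injEq, and_true]
  funext a
  by_cases ha : a = d
  · subst ha; simp
  · simp [ha]

/-- `d := d + ∑ y ∈ S, f y * g y` for cached factors. -/
noncomputable def dot (d : Fin M) (S : Finset α) (f g : α → Fin M) : List (Instr M) :=
  update d (forEach S fun y => [Instr.muladd d (f y) (g y)])

@[simp] theorem flopsOf_dot (d : Fin M) (S : Finset α) (f g : α → Fin M) :
    flopsOf (dot d S f g) = S.card * 2 := by
  simp [dot, Instr.flops]

@[simp] theorem trafficOf_dot (d : Fin M) (S : Finset α) (f g : α → Fin M) :
    trafficOf (dot d S f g) = 2 := by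
  simp [dot, Instr.traffic]

theorem Adds.dot {H : ℕ} {κ : Fin M → Option ℝ} {Z : Set (Fin M)} {μ₀ : Fin M → ℝ}
    {d : Fin M} {S : Finset α} {f g : α → Fin M} {u v : α → ℝ} (hdZ : d ∉ Z)
    (hd : κ d = none) (hc : (supp κ).card + 1 ≤ H)
    (hf : ∀ y ∈ S, κ (f y) = some (u y)) (hg : ∀ y ∈ S, κ (g y) = some (v y)) :
    Adds H κ Z μ₀ (dot d S f g) (Pi.single d (∑ y ∈ S, u y * v y)) := by
  refine Adds.update hdZ hd hc fun y hy μ t _ => ?_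
  have h1 : f y ≠ d := fun e => by simp [← e, hf y hy] at hd
  have h2 : g y ≠ d := fun e => by simp [← e, hg y hy] at hd
  have h3 := card_supp_update_le κ d (some t)
  refine runInstrs_cons_of ?_ rfl
  simp only [Instr.run, Function.update_self, ne_eq, h1, not_false_eq_true,
    Function.update_of_ne, hf y hy, h2, hg y hy, Option.bind_some]
  rw [put_eq, Function.update_idem]
  rw [supp_update_update]
  omega

/-- `d := d + ∑ y ∈ S, g y` for words `g y` in main memory. -/
noncomputable def addUp (d : Fin M) (S : Finset α) (g : α → Fin M) : List (Instr M) :=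
  update d (forEach S fun y => [Instr.load (g y), Instr.add d d (g y), Instr.evict (g y)])

@[simp] theorem flopsOf_addUp (d : Fin M) (S : Finset α) (g : α → Fin M) :
    flopsOf (addUp d S g) = S.card := by
  simp [addUp, Instr.flops]

@[simp] theorem trafficOf_addUp (d : Fin M) (S : Finset α) (g : α → Fin M) :
    trafficOf (addUp d S g) = S.card + 2 := by
  simp [addUp, Instr.traffic]

theorem Adds.addUp {H : ℕ} {κ : Fin M → Option ℝ} {Z : Set (Fin M)} {μ₀ : Fin M → ℝ}
    {d : Fin M} {S : Finset α} {g : α → Fin M} (hdZ : d ∉ Z)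
    (hd : κ d = none) (hc : (supp κ).card + 2 ≤ H)
    (hgZ : ∀ y ∈ S, g y ∈ Z) (hg : ∀ y ∈ S, κ (g y) = none) :
    Adds H κ Z μ₀ (addUp d S g) (Pi.single d (∑ y ∈ S, μ₀ (g y))) := by
  refine Adds.update hdZ hd (by omega) fun y hy μ t hμ => ?_
  have h2 : g y ≠ d := fun e => hdZ (e ▸ hgZ y hy)
  have h3 := card_supp_update_le κ d (some t)
  have h4 := card_supp_update_le (Function.update κ d (some t)) (g y) (some (μ (g y)))
  refine runInstrs_cons_of (s' := ⟨μ, Function.update (Function.update κ d (some t)) (g y)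
    (some (μ (g y)))⟩) (put_eq (h4.trans (by omega))) ?_
  refine runInstrs_cons_of (s' := ⟨μ, Function.update (Function.update κ (g y)
    (some (μ (g y)))) d (some (t + μ (g y)))⟩) ?_ ?_
  · rw [Function.update_comm h2.symm] at h4 ⊢
    simp only [Instr.run, Function.update_self, ne_eq, h2, not_false_eq_true,
      Function.update_of_ne, Option.bind_some]
    rw [put_eq, Function.update_idem]
    rw [supp_update_update]
    omega
  refine runInstrs_cons_of (s' := ⟨μ, Function.update κ d (some (t + μ₀ (g y)))⟩) ?_ rfl
  simp only [Instr.run, Option.some.injEq, LocalState.mk.injEq, true_and]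
  rw [Function.update_comm h2, Function.update_idem, ← hμ (hgZ y hy)]
  rw [← hg y hy, Function.update_comm h2.symm, Function.update_eq_self]

end BSP

/-! ### Multiplication of blocks on one processor. -/

namespace BSP

variable {M : ℕ}

/-- The number of the part that contains `x` if `S` is cut into parts of `s` elements. -/
noncomputable def chunk {α : Type*} [DecidableEq α] (S : Finset α) (s : ℕ) (x : α) : ℕ :=
  if h : x ∈ S then (S.equivFin ⟨x, h⟩).val / s else 0

theorem chunk_lt {α : Type*} [DecidableEq α] {S : Finset α} {x : α} (hx : x ∈ S) (s : ℕ) :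
    chunk S s x < S.card / s + 1 := by
  simp only [chunk, hx, dif_pos]
  exact Nat.lt_succ_of_le (Nat.div_le_div_right (S.equivFin ⟨x, hx⟩).isLt.le)

/-- In the enumeration of `S`, the indices of the elements of part `u` lie in the interval from `u *
s` to `u * s + s`. -/
theorem card_chunk_le {α : Type*} [DecidableEq α] (S : Finset α) {s : ℕ} (hs : 0 < s) (u : ℕ) :
    (S.filter fun x => chunk S s x = u).card ≤ s := by
  have h : (Finset.Ico (u * s) (u * s + s)).card = s := by simp
  refine le_of_le_of_eq ?_ h
  refine Finset.card_le_card_of_injOn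
    (fun x => if h : x ∈ S then (S.equivFin ⟨x, h⟩).val else 0) ?_ ?_
  · intro x hx
    obtain ⟨hx, hu⟩ := Finset.mem_filter.1 hx
    simp only [chunk, hx, dif_pos] at hu
    simp only [hx, dif_pos, Finset.coe_Ico, Set.mem_Ico]
    rw [← hu]
    refine ⟨Nat.div_mul_le_self _ _, ?_⟩
    have := Nat.lt_div_mul_add (a := (S.equivFin ⟨x, hx⟩).val) hs
    exact this
  · intro x hx y hy hxy
    have hx := (Finset.mem_filter.1 hx).1
    have hy := (Finset.mem_filter.1 hy).1
    simp only [hx, hy, dif_pos] at hxy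
    simpa using S.equivFin.injective (Fin.ext hxy)

/-- A cache that holds copies of the words of `μ` at the addresses in `S` and nothing else. -/
def resident (S : Finset (Fin M)) (μ : Fin M → ℝ) : Fin M → Option ℝ := overlay (fun _ => none) S μ

theorem card_supp_resident_le (S : Finset (Fin M)) (μ : Fin M → ℝ) :
    (supp (resident S μ)).card ≤ S.card := by
  have h := card_supp_overlay_le (fun _ => none) S μ
  have h0 : (supp fun _ : Fin M => (none : Option ℝ)).card = 0 := by simp [supp]
  rwa [h0, zero_add] at h

theorem resident_of_mem {S : Finset (Fin M)} {a : Fin M} (h : a ∈ S) (μ : Fin M → ℝ) :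
    resident S μ a = some (μ a) := by
  simp [resident, overlay, h]

theorem resident_of_notMem {S : Finset (Fin M)} {a : Fin M} (h : a ∉ S) (μ : Fin M → ℝ) :
    resident S μ a = none := by
  simp [resident, overlay, h]

theorem resident_congr {S : Finset (Fin M)} {μ μ' : Fin M → ℝ} (h : ∀ a ∈ S, μ a = μ' a) :
    resident S μ = resident S μ' := by
  funext a
  by_cases ha : a ∈ S
  · simp [resident, overlay, ha, h a ha]
  · simp [resident, overlay, ha]

variable {ρ η ξ : Type*}

/-- The addresses of the entries of a block of rows `R` and columns `Y`. -/
def blockAddrs (f : ρ → η → Fin M) (R : Finset ρ) (Y : Finset η) : Finset (Fin M) :=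
  (R ×ˢ Y).image fun e => f e.1 e.2

theorem card_blockAddrs_le (f : ρ → η → Fin M) (R : Finset ρ) (Y : Finset η) :
    (blockAddrs f R Y).card ≤ R.card * Y.card :=
  Finset.card_image_le.trans (Finset.card_product _ _).le

theorem mem_blockAddrs {f : ρ → η → Fin M} {R : Finset ρ} {Y : Finset η} {a : Fin M} :
    a ∈ blockAddrs f R Y ↔ ∃ r ∈ R, ∃ y ∈ Y, f r y = a := by
  simp only [blockAddrs, Finset.mem_image, Finset.mem_product, Prod.exists]
  grind

/-- `fc r x += ∑ y ∈ Y, fa r y * fb y x` for `r ∈ R` and `x ∈ X`; the words `fa r y` are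
in cache. -/
noncomputable def cachedTile (fa : ρ → η → Fin M) (fb : η → ξ → Fin M) (fc : ρ → ξ → Fin M)
    (X : Finset ξ) (R : Finset ρ) (Y : Finset η) : List (Instr M) :=
  forEach X fun x => loads (Y.image fun y => fb y x) ++
    forEach R (fun r => dot (fc r x) Y (fa r) fun y => fb y x) ++
    evicts (Y.image fun y => fb y x)

/-- `fc r x += ∑ y ∈ Y, fa r y * fb y x` for `r ∈ R` and `x ∈ X`. -/
noncomputable def tile (fa : ρ → η → Fin M) (fb : η → ξ → Fin M) (fc : ρ → ξ → Fin M)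
    (X : Finset ξ) (R : Finset ρ) (Y : Finset η) : List (Instr M) :=
  loads (blockAddrs fa R Y) ++ cachedTile fa fb fc X R Y ++ evicts (blockAddrs fa R Y)

section

variable [DecidableEq ρ] [DecidableEq η]

/-- `fc r x += ∑ y ∈ Y, fa r y * fb y x` for `r ∈ R` and `x ∈ X`, by tiles of size at most
`s × s`. -/
noncomputable def tiles (fa : ρ → η → Fin M) (fb : η → ξ → Fin M) (fc : ρ → ξ → Fin M)
    (X : Finset ξ) (s : ℕ) (R : Finset ρ) (Y : Finset η) : List (Instr M) :=
  forEach (Finset.range (R.card / s + 1)) fun u => forEach (Finset.range (Y.card / s + 1)) fun v =>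
    tile fa fb fc X (R.filter fun r => chunk R s r = u) (Y.filter fun y => chunk Y s y = v)

/-- `fc r x := ∑ y ∈ Y, fa r y * fb y x` for `r ∈ R` and `x ∈ X`, where the words `fa r y` with
`r ∈ R₀` are in cache. -/
noncomputable def multiply (fa : ρ → η → Fin M) (fb : η → ξ → Fin M) (fc : ρ → ξ → Fin M)
    (X : Finset ξ) (s : ℕ) (R R₀ : Finset ρ) (Y : Finset η) : List (Instr M) :=
  zeros (blockAddrs fc R X) ++ ((if R₀ = ∅ then [] else cachedTile fa fb fc X R₀ Y) ++
    tiles fa fb fc X s (R \ R₀) Y)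

end

/-! #### Cost -/

theorem flopsOf_cachedTile (fa : ρ → η → Fin M) (fb : η → ξ → Fin M) (fc : ρ → ξ → Fin M)
    (X : Finset ξ) (R : Finset ρ) (Y : Finset η) :
    flopsOf (cachedTile fa fb fc X R Y) = 2 * X.card * (R.card * Y.card) := by
  simp [cachedTile]
  ring

theorem trafficOf_cachedTile_le (fa : ρ → η → Fin M) (fb : η → ξ → Fin M) (fc : ρ → ξ → Fin M)
    (X : Finset ξ) (R : Finset ρ) (Y : Finset η) :
    trafficOf (cachedTile fa fb fc X R Y) ≤ X.card * (Y.card + 2 * R.card) := by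
  simp only [cachedTile, trafficOf_forEach, trafficOf_append, trafficOf_loads, trafficOf_evicts,
    trafficOf_dot, Finset.sum_const, smul_eq_mul]
  refine Finset.sum_le_card_nsmul _ _ _ fun x _ => ?_
  have : (Y.image fun y => fb y x).card ≤ Y.card := Finset.card_image_le
  omega

theorem flopsOf_tile (fa : ρ → η → Fin M) (fb : η → ξ → Fin M) (fc : ρ → ξ → Fin M)
    (X : Finset ξ) (R : Finset ρ) (Y : Finset η) :
    flopsOf (tile fa fb fc X R Y) = 2 * X.card * (R.card * Y.card) := by
  simp [tile, flopsOf_cachedTile]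

theorem trafficOf_tile_le (fa : ρ → η → Fin M) (fb : η → ξ → Fin M) (fc : ρ → ξ → Fin M)
    (X : Finset ξ) (R : Finset ρ) (Y : Finset η) :
    trafficOf (tile fa fb fc X R Y) ≤ R.card * Y.card + X.card * (Y.card + 2 * R.card) := by
  simp only [tile, trafficOf_append, trafficOf_loads, trafficOf_evicts, add_zero]
  exact add_le_add (card_blockAddrs_le _ _ _) (trafficOf_cachedTile_le _ _ _ _ _ _)

theorem sum_card_chunk {α : Type*} [DecidableEq α] (S : Finset α) (s : ℕ) :
    ∑ u ∈ Finset.range (S.card / s + 1), (S.filter fun x => chunk S s x = u).card = S.card :=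
  (Finset.card_eq_sum_card_fiberwise fun _ hx =>
    Finset.mem_coe.2 (Finset.mem_range.2 (chunk_lt hx s))).symm

section

variable [DecidableEq ρ] [DecidableEq η]

theorem flopsOf_tiles (fa : ρ → η → Fin M) (fb : η → ξ → Fin M) (fc : ρ → ξ → Fin M)
    (X : Finset ξ) (s : ℕ) (R : Finset ρ) (Y : Finset η) :
    flopsOf (tiles fa fb fc X s R Y) = 2 * X.card * (R.card * Y.card) := by
  simp only [tiles, flopsOf_forEach, flopsOf_tile, ← Finset.mul_sum, sum_card_chunk,
    ← Finset.sum_mul]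

/-- Each entry of the left factor lies in one tile and is loaded once. An entry of the right factor
is loaded once per strip of rows, and an entry of the product is loaded and stored once per strip of
inner indices. -/
theorem trafficOf_tiles_le (fa : ρ → η → Fin M) (fb : η → ξ → Fin M) (fc : ρ → ξ → Fin M)
    (X : Finset ξ) (s : ℕ) (R : Finset ρ) (Y : Finset η) :
    trafficOf (tiles fa fb fc X s R Y) ≤ R.card * Y.card +
      X.card * (Y.card * (R.card / s + 1) + 2 * (R.card * (Y.card / s + 1))) := by
  simp only [tiles, trafficOf_forEach]
  refine (Finset.sum_le_sum fun u _ => Finset.sum_le_sum fun v _ =>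
    trafficOf_tile_le fa fb fc X _ _).trans ?_
  simp only [Finset.sum_add_distrib, ← Finset.mul_sum, sum_card_chunk, ← Finset.sum_mul,
    Finset.sum_const, Finset.card_range, smul_eq_mul]
  refine le_of_eq ?_
  ring

theorem flopsOf_multiply_le (fa : ρ → η → Fin M) (fb : η → ξ → Fin M) (fc : ρ → ξ → Fin M)
    (X : Finset ξ) (s : ℕ) {R R₀ : Finset ρ} (h : R₀ ⊆ R) (Y : Finset η) :
    flopsOf (multiply fa fb fc X s R R₀ Y) ≤
      R.card * X.card + 2 * X.card * (R.card * Y.card) := by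
  have h1 := card_blockAddrs_le fc R X
  have h2 : flopsOf (if R₀ = ∅ then [] else cachedTile fa fb fc X R₀ Y) =
      2 * X.card * (R₀.card * Y.card) := by
    split_ifs with h0
    · simp [h0]
    · exact flopsOf_cachedTile _ _ _ _ _ _
  have h3 := Finset.card_sdiff_add_card_eq_card h
  simp only [multiply, flopsOf_append, flopsOf_zeros, flopsOf_tiles, h2]
  rw [← h3] at h1 ⊢
  nlinarith

theorem trafficOf_multiply_le (fa : ρ → η → Fin M) (fb : η → ξ → Fin M) (fc : ρ → ξ → Fin M)
    (X : Finset ξ) (s : ℕ) (R R₀ : Finset ρ) (Y : Finset η) :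
    trafficOf (multiply fa fb fc X s R R₀ Y) ≤
      R.card * X.card + (if R₀ = ∅ then 0 else X.card * (Y.card + 2 * R₀.card)) +
      ((R \ R₀).card * Y.card + X.card * (Y.card * ((R \ R₀).card / s + 1) +
        2 * ((R \ R₀).card * (Y.card / s + 1)))) := by
  have h1 := card_blockAddrs_le fc R X
  have h3 := trafficOf_tiles_le fa fb fc X s (R \ R₀) Y
  simp only [multiply, trafficOf_append, trafficOf_zeros]
  split_ifs with h0
  · simp only [trafficOf_nil]
    omega
  · have := trafficOf_cachedTile_le fa fb fc X R₀ Y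
    omega

end

/-! #### Correctness -/

section

variable {H : ℕ} {κ : Fin M → Option ℝ} {Z : Set (Fin M)} {μ₀ : Fin M → ℝ}
  {fa : ρ → η → Fin M} {fb : η → ξ → Fin M} {fc : ρ → ξ → Fin M}
  {X : Finset ξ} {R : Finset ρ} {Y : Finset η}

/-- For each `x` the whole column of the right factor is cached and serves all rows; beyond it only
one word is needed, for the accumulator of `dot`. -/
theorem Adds.cachedTile (ha : ∀ r ∈ R, ∀ y ∈ Y, κ (fa r y) = some (μ₀ (fa r y)))
    (hbZ : ∀ y ∈ Y, ∀ x ∈ X, fb y x ∈ Z) (hb : ∀ y ∈ Y, ∀ x ∈ X, κ (fb y x) = none)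
    (hcZ : ∀ r ∈ R, ∀ x ∈ X, fc r x ∉ Z) (hc : ∀ r ∈ R, ∀ x ∈ X, κ (fc r x) = none)
    (hcap : (supp κ).card + Y.card + 1 ≤ H) :
    Adds H κ Z μ₀ (cachedTile fa fb fc X R Y) (∑ x ∈ X, ∑ r ∈ R,
      Pi.single (fc r x) (∑ y ∈ Y, μ₀ (fa r y) * μ₀ (fb y x))) := by
  refine Adds.forEach fun x hx => ?_
  have hcard : (Y.image fun y => fb y x).card ≤ Y.card := Finset.card_image_le
  have hcard' := card_supp_overlay_le κ (Y.image fun y => fb y x) μ₀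
  refine Adds.wrap (Adds.forEach fun r hr => ?_) ?_ ?_ (by omega)
  · refine Adds.dot (hcZ r hr x hx) ?_ (by omega) (fun y hy => ?_) fun y hy => ?_
    · have : fc r x ∉ Y.image fun y => fb y x := by
        intro h
        obtain ⟨y, hy, e⟩ := Finset.mem_image.1 h
        exact hcZ r hr x hx (e ▸ hbZ y hy x hx)
      simp only [overlay, this, if_false, hc r hr x hx]
    · simp only [overlay, ha r hr y hy, ite_self]
    · simp only [overlay, Finset.mem_image_of_mem (fun y => fb y x) hy, if_true]
  · intro a ha
    obtain ⟨y, hy, rfl⟩ := Finset.mem_image.1 ha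
    exact hbZ y hy x hx
  · intro a ha
    obtain ⟨y, hy, rfl⟩ := Finset.mem_image.1 ha
    exact hb y hy x hx

theorem Adds.tile (haZ : ∀ r ∈ R, ∀ y ∈ Y, fa r y ∈ Z) (ha : ∀ r ∈ R, ∀ y ∈ Y, κ (fa r y) = none)
    (hbZ : ∀ y ∈ Y, ∀ x ∈ X, fb y x ∈ Z) (hb : ∀ y ∈ Y, ∀ x ∈ X, κ (fb y x) = none)
    (hab : ∀ r ∈ R, ∀ y ∈ Y, ∀ y' ∈ Y, ∀ x ∈ X, fa r y ≠ fb y' x)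
    (hcZ : ∀ r ∈ R, ∀ x ∈ X, fc r x ∉ Z) (hc : ∀ r ∈ R, ∀ x ∈ X, κ (fc r x) = none)
    (hcap : (supp κ).card + R.card * Y.card + Y.card + 1 ≤ H) :
    Adds H κ Z μ₀ (tile fa fb fc X R Y) (∑ x ∈ X, ∑ r ∈ R,
      Pi.single (fc r x) (∑ y ∈ Y, μ₀ (fa r y) * μ₀ (fb y x))) := by
  have h1 := card_blockAddrs_le fa R Y
  have h2 := card_supp_overlay_le κ (blockAddrs fa R Y) μ₀
  refine Adds.wrap (Adds.cachedTile ?_ hbZ ?_ hcZ ?_ (by omega)) ?_ ?_ (by omega)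
  · intro r hr y hy
    have : fa r y ∈ blockAddrs fa R Y := mem_blockAddrs.2 ⟨r, hr, y, hy, rfl⟩
    simp only [overlay, this, if_true]
  · intro y hy x hx
    have : fb y x ∉ blockAddrs fa R Y := by
      rw [mem_blockAddrs]
      rintro ⟨r, hr, y', hy', e⟩
      exact hab r hr y' hy' y hy x hx e
    simp only [overlay, this, if_false, hb y hy x hx]
  · intro r hr x hx
    have : fc r x ∉ blockAddrs fa R Y := by
      rw [mem_blockAddrs]
      rintro ⟨r', hr', y', hy', e⟩
      exact hcZ r hr x hx (e ▸ haZ r' hr' y' hy')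
    simp only [overlay, this, if_false, hc r hr x hx]
  · intro a h
    obtain ⟨r, hr, y, hy, rfl⟩ := mem_blockAddrs.1 h
    exact haZ r hr y hy
  · intro a h
    obtain ⟨r, hr, y, hy, rfl⟩ := mem_blockAddrs.1 h
    exact ha r hr y hy

/-- Distinct entries have distinct addresses, so only one summand is nonzero at a given address. -/
theorem sum_single_apply (hinj : ∀ r ∈ R, ∀ x ∈ X, ∀ r' ∈ R, ∀ x' ∈ X,
    fc r x = fc r' x' → r = r' ∧ x = x') (v : ρ → ξ → ℝ) {r₀ : ρ} (hr₀ : r₀ ∈ R) {x₀ : ξ}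
    (hx₀ : x₀ ∈ X) :
    (∑ x ∈ X, ∑ r ∈ R, Pi.single (M := fun _ : Fin M => ℝ) (fc r x) (v r x)) (fc r₀ x₀) =
      v r₀ x₀ := by
  classical
  simp only [Finset.sum_apply]
  rw [Finset.sum_eq_single x₀, Finset.sum_eq_single r₀]
  · simp
  · intro r hr hne
    exact Pi.single_eq_of_ne (fun e => hne (hinj r₀ hr₀ x₀ hx₀ r hr x₀ hx₀ e).1.symm) _
  · exact fun h => absurd hr₀ h
  · intro x hx hne
    refine Finset.sum_eq_zero fun r hr => ?_
    exact Pi.single_eq_of_ne (fun e => hne (hinj r₀ hr₀ x₀ hx₀ r hr x hx e).2.symm) _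
  · exact fun h => absurd hx₀ h

variable [DecidableEq ρ] [DecidableEq η]

/-- A tile needs `s * s` words for the left factor, `s` for part of a column of the right factor and
one for the accumulator. -/
theorem Adds.tiles {s : ℕ} (hs : 0 < s)
    (haZ : ∀ r ∈ R, ∀ y ∈ Y, fa r y ∈ Z) (ha : ∀ r ∈ R, ∀ y ∈ Y, κ (fa r y) = none)
    (hbZ : ∀ y ∈ Y, ∀ x ∈ X, fb y x ∈ Z) (hb : ∀ y ∈ Y, ∀ x ∈ X, κ (fb y x) = none)
    (hab : ∀ r ∈ R, ∀ y ∈ Y, ∀ y' ∈ Y, ∀ x ∈ X, fa r y ≠ fb y' x)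
    (hcZ : ∀ r ∈ R, ∀ x ∈ X, fc r x ∉ Z) (hc : ∀ r ∈ R, ∀ x ∈ X, κ (fc r x) = none)
    (hcap : (supp κ).card + s * s + s + 1 ≤ H) :
    Adds H κ Z μ₀ (tiles fa fb fc X s R Y) (∑ x ∈ X, ∑ r ∈ R,
      Pi.single (fc r x) (∑ y ∈ Y, μ₀ (fa r y) * μ₀ (fb y x))) := by
  -- The total update is the sum of the updates of the tiles: rows and inner indices are grouped by
  -- their chunks, and `Pi.single` is additive in its value.
  have key : ∑ x ∈ X, ∑ r ∈ R, Pi.single (M := fun _ : Fin M => ℝ) (fc r x)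
        (∑ y ∈ Y, μ₀ (fa r y) * μ₀ (fb y x)) =
      ∑ u ∈ Finset.range (R.card / s + 1), ∑ v ∈ Finset.range (Y.card / s + 1),
        ∑ x ∈ X, ∑ r ∈ R.filter (fun r => chunk R s r = u),
          Pi.single (M := fun _ : Fin M => ℝ) (fc r x)
            (∑ y ∈ Y.filter (fun y => chunk Y s y = v), μ₀ (fa r y) * μ₀ (fb y x)) := by
    have h1 : ∀ r x, Pi.single (M := fun _ : Fin M => ℝ) (fc r x)
        (∑ y ∈ Y, μ₀ (fa r y) * μ₀ (fb y x)) = ∑ v ∈ Finset.range (Y.card / s + 1),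
          Pi.single (M := fun _ : Fin M => ℝ) (fc r x)
            (∑ y ∈ Y.filter (fun y => chunk Y s y = v), μ₀ (fa r y) * μ₀ (fb y x)) := by
      intro r x
      rw [← Finset.sum_fiberwise_of_maps_to (t := Finset.range (Y.card / s + 1))
        (g := chunk Y s) fun y hy => Finset.mem_range.2 (chunk_lt hy s)]
      exact map_sum (AddMonoidHom.single (fun _ : Fin M => ℝ) (fc r x)) _ _
    simp only [h1]
    have h2 : ∀ x, ∑ r ∈ R, ∑ v ∈ Finset.range (Y.card / s + 1),
          Pi.single (M := fun _ : Fin M => ℝ) (fc r x)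
            (∑ y ∈ Y.filter (fun y => chunk Y s y = v), μ₀ (fa r y) * μ₀ (fb y x)) =
        ∑ u ∈ Finset.range (R.card / s + 1), ∑ v ∈ Finset.range (Y.card / s + 1),
          ∑ r ∈ R.filter (fun r => chunk R s r = u), Pi.single (M := fun _ : Fin M => ℝ) (fc r x)
            (∑ y ∈ Y.filter (fun y => chunk Y s y = v), μ₀ (fa r y) * μ₀ (fb y x)) := by
      intro x
      rw [← Finset.sum_fiberwise_of_maps_to (t := Finset.range (R.card / s + 1))
        (g := chunk R s) fun r hr => Finset.mem_range.2 (chunk_lt hr s)]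
      exact Finset.sum_congr rfl fun u _ => Finset.sum_comm
    simp only [h2]
    rw [Finset.sum_comm]
    exact Finset.sum_congr rfl fun u _ => Finset.sum_comm
  rw [key]
  refine Adds.forEach fun u _ => Adds.forEach fun v _ => ?_
  have h1 := card_chunk_le R hs u
  have h2 := card_chunk_le Y hs v
  have h3 := Nat.mul_le_mul h1 h2
  have hR := Finset.filter_subset (fun r => chunk R s r = u) R
  have hY := Finset.filter_subset (fun y => chunk Y s y = v) Y
  exact Adds.tile (fun r hr y hy => haZ r (hR hr) y (hY hy))
    (fun r hr y hy => ha r (hR hr) y (hY hy)) (fun y hy => hbZ y (hY hy))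
    (fun y hy => hb y (hY hy)) (fun r hr y hy y' hy' => hab r (hR hr) y (hY hy) y' (hY hy'))
    (fun r hr => hcZ r (hR hr)) (fun r hr => hc r (hR hr)) (by omega)

/-- After the targets are zeroed, adding the products amounts to assigning them. The read-only set
`Z` consists of all addresses that are not targets; it contains both factors, hence also the cached
rows, whose copies remain valid. -/
theorem runInstrs_multiply {s : ℕ} (hs : 0 < s) {R₀ : Finset ρ} (hR₀ : R₀ ⊆ R)
    (hca : ∀ r ∈ R, ∀ x ∈ X, ∀ r' ∈ R, ∀ y ∈ Y, fc r x ≠ fa r' y)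
    (hcb : ∀ r ∈ R, ∀ x ∈ X, ∀ y ∈ Y, ∀ x' ∈ X, fc r x ≠ fb y x')
    (hab : ∀ r ∈ R, ∀ y ∈ Y, ∀ y' ∈ Y, ∀ x ∈ X, fa r y ≠ fb y' x)
    (haa : ∀ r ∈ R, ∀ y ∈ Y, ∀ r' ∈ R, ∀ y' ∈ Y, fa r y = fa r' y' → r = r')
    (hcc : ∀ r ∈ R, ∀ x ∈ X, ∀ r' ∈ R, ∀ x' ∈ X, fc r x = fc r' x' → r = r' ∧ x = x')
    (hcap₀ : R₀ = ∅ ∨ R₀.card * Y.card + Y.card + 1 ≤ H)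
    (hcap : R₀.card * Y.card + s * s + s + 1 ≤ H) (μ : Fin M → ℝ) :
    ∃ μ', runInstrs H (multiply fa fb fc X s R R₀ Y) ⟨μ, resident (blockAddrs fa R₀ Y) μ⟩ =
        some ⟨μ', resident (blockAddrs fa R₀ Y) μ'⟩ ∧
      (∀ a, (∀ r ∈ R, ∀ x ∈ X, fc r x ≠ a) → μ' a = μ a) ∧
      ∀ r ∈ R, ∀ x ∈ X, μ' (fc r x) = ∑ y ∈ Y, μ (fa r y) * μ (fb y x) := by
  set κ := resident (blockAddrs fa R₀ Y) μ with hκ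
  have hcard : (supp κ).card ≤ R₀.card * Y.card :=
    (card_supp_resident_le _ _).trans (card_blockAddrs_le _ _ _)
  have hnone : ∀ a, (∀ r ∈ R₀, ∀ y ∈ Y, fa r y ≠ a) → κ a = none := by
    intro a h
    refine resident_of_notMem ?_ _
    rw [mem_blockAddrs]
    rintro ⟨r, hr, y, hy, e⟩
    exact h r hr y hy e
  set μ₁ : Fin M → ℝ := fun a => if a ∈ blockAddrs fc R X then 0 else μ a with hμ₁
  have hμ₁c : ∀ r ∈ R, ∀ x ∈ X, μ₁ (fc r x) = 0 := by
    intro r hr x hx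
    have : fc r x ∈ blockAddrs fc R X := mem_blockAddrs.2 ⟨r, hr, x, hx, rfl⟩
    simp only [hμ₁, this, if_true]
  have hμ₁z : ∀ a, (∀ r ∈ R, ∀ x ∈ X, fc r x ≠ a) → μ₁ a = μ a := by
    intro a ha
    have : a ∉ blockAddrs fc R X := by
      rw [mem_blockAddrs]
      rintro ⟨r, hr, x, hx, e⟩
      exact ha r hr x hx e
    simp only [hμ₁, this, if_false]
  have hc : ∀ r ∈ R, ∀ x ∈ X, κ (fc r x) = none := fun r hr x hx =>
    hnone _ fun r' hr' y hy e => hca r hr x hx r' (hR₀ hr') y hy e.symm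
  have hb : ∀ y ∈ Y, ∀ x ∈ X, κ (fb y x) = none := fun y hy x hx =>
    hnone _ fun r' hr' y' hy' => hab r' (hR₀ hr') y' hy' y hy x hx
  set Z : Set (Fin M) := {a | ∀ r ∈ R, ∀ x ∈ X, fc r x ≠ a} with hZ
  have hcZ : ∀ r ∈ R, ∀ x ∈ X, fc r x ∉ Z := fun r hr x hx h => h r hr x hx rfl
  have haZ : ∀ r ∈ R, ∀ y ∈ Y, fa r y ∈ Z := fun r hr y hy r' hr' x hx => hca r' hr' x hx r hr y hy
  have hbZ : ∀ y ∈ Y, ∀ x ∈ X, fb y x ∈ Z := fun y hy x hx r' hr' x' hx' =>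
    hcb r' hr' x' hx' y hy x hx
  have h1 : Adds H κ Z μ₁ (if R₀ = ∅ then [] else cachedTile fa fb fc X R₀ Y)
      (∑ x ∈ X, ∑ r ∈ R₀, Pi.single (fc r x) (∑ y ∈ Y, μ₁ (fa r y) * μ₁ (fb y x))) := by
    -- For `R₀ = ∅` the cached part has to be skipped: it would load whole columns of the right
    -- factor, for which a small cache has no room.
    split_ifs with h0
    · simpa [h0] using Adds.nil
    · refine Adds.cachedTile (fun r hr y hy => ?_) hbZ hb (fun r hr => hcZ r (hR₀ hr))
        (fun r hr => hc r (hR₀ hr)) ?_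
      · rw [hμ₁z _ (haZ r (hR₀ hr) y hy)]
        exact resident_of_mem (mem_blockAddrs.2 ⟨r, hr, y, hy, rfl⟩) _
      · have := hcap₀.resolve_left h0
        omega
  have h2 : Adds H κ Z μ₁ (tiles fa fb fc X s (R \ R₀) Y)
      (∑ x ∈ X, ∑ r ∈ R \ R₀, Pi.single (fc r x) (∑ y ∈ Y, μ₁ (fa r y) * μ₁ (fb y x))) := by
    have hsub : ∀ r ∈ R \ R₀, r ∈ R := fun r hr => (Finset.mem_sdiff.1 hr).1
    refine Adds.tiles hs (fun r hr => haZ r (hsub r hr)) (fun r hr y hy => ?_) hbZ hb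
      (fun r hr => hab r (hsub r hr)) (fun r hr => hcZ r (hsub r hr))
      (fun r hr => hc r (hsub r hr)) (by omega)
    -- A row outside `R₀` shares no address with a kept row by `haa`, so its words are not cached
    -- and can be loaded and evicted freely.
    refine hnone _ fun r' hr' y' hy' e => ?_
    have := haa r' (hR₀ hr') y' hy' r (hsub r hr) y hy e
    exact (Finset.mem_sdiff.1 hr).2 (this ▸ hr')
  have h3 := h1.append h2
  rw [← Finset.sum_add_distrib] at h3
  simp only [fun x => add_comm (∑ r ∈ R₀, Pi.single (M := fun _ : Fin M => ℝ) (fc r x)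
    (∑ y ∈ Y, μ₁ (fa r y) * μ₁ (fb y x))), Finset.sum_sdiff hR₀] at h3
  -- The kept words lie in `Z`, so the old cache is also the exact copy of the new memory.
  have hres : κ = resident (blockAddrs fa R₀ Y) (μ₁ + ∑ x ∈ X, ∑ r ∈ R,
      Pi.single (fc r x) (∑ y ∈ Y, μ₁ (fa r y) * μ₁ (fb y x))) := by
    refine resident_congr fun a ha => ?_
    obtain ⟨r, hr, y, hy, rfl⟩ := mem_blockAddrs.1 ha
    have := haZ r (hR₀ hr) y hy
    rw [Pi.add_apply, h3.zero _ this, hμ₁z _ this, add_zero]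
  refine ⟨μ₁ + ∑ x ∈ X, ∑ r ∈ R, Pi.single (fc r x)
    (∑ y ∈ Y, μ₁ (fa r y) * μ₁ (fb y x)), ?_, ?_, ?_⟩
  · rw [← hres]
    refine runInstrs_append_of (runInstrs_zeros _ _ _ (by omega) ?_) (h3.run μ₁ fun _ _ => rfl)
    intro a ha
    obtain ⟨r, hr, x, hx, rfl⟩ := mem_blockAddrs.1 ha
    exact hc r hr x hx
  · intro a ha
    rw [Pi.add_apply, h3.zero a ha, hμ₁z a ha, add_zero]
  · intro r hr x hx
    rw [Pi.add_apply, hμ₁c r hr x hx, zero_add, sum_single_apply hcc _ hr hx]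
    exact Finset.sum_congr rfl fun y hy => by
      rw [hμ₁z _ (haZ r hr y hy), hμ₁z _ (hbZ y hy x hx)]

end

end BSP

/-! ### Summation of received pieces, message exchange, and runs of programs. -/

namespace BSP

variable {M : ℕ} {ρ ξ : Type*}

/-- `fo r x := ∑ j ∈ J, fp j r x` for `r ∈ R` and `x ∈ X`. -/
noncomputable def sumUp {ζ : Type*} (fp : ζ → ρ → ξ → Fin M) (fo : ρ → ξ → Fin M) (J : Finset ζ)
    (R : Finset ρ) (X : Finset ξ) : List (Instr M) :=
  zeros (blockAddrs fo R X) ++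
    forEach X fun x => forEach R fun r => addUp (fo r x) J fun j => fp j r x

theorem flopsOf_sumUp_le {ζ : Type*} (fp : ζ → ρ → ξ → Fin M) (fo : ρ → ξ → Fin M) (J : Finset ζ)
    (R : Finset ρ) (X : Finset ξ) :
    flopsOf (sumUp fp fo J R X) ≤ R.card * X.card * (J.card + 1) := by
  have h := card_blockAddrs_le fo R X
  simp only [sumUp, flopsOf_append, flopsOf_zeros, flopsOf_forEach, flopsOf_addUp,
    Finset.sum_const, smul_eq_mul]
  nlinarith

theorem trafficOf_sumUp_le {ζ : Type*} (fp : ζ → ρ → ξ → Fin M) (fo : ρ → ξ → Fin M)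
    (J : Finset ζ) (R : Finset ρ) (X : Finset ξ) :
    trafficOf (sumUp fp fo J R X) ≤ R.card * X.card * (J.card + 3) := by
  have h := card_blockAddrs_le fo R X
  simp only [sumUp, trafficOf_append, trafficOf_zeros, trafficOf_forEach, trafficOf_addUp,
    Finset.sum_const, smul_eq_mul]
  nlinarith

/-- The argument is that of `runInstrs_multiply`; besides the resident words, the cache holds one
accumulator and one summand. -/
theorem runInstrs_sumUp {ζ : Type*} {H : ℕ} {S : Finset (Fin M)} {fp : ζ → ρ → ξ → Fin M}
    {fo : ρ → ξ → Fin M} {J : Finset ζ} {R : Finset ρ} {X : Finset ξ}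
    (hoS : ∀ r ∈ R, ∀ x ∈ X, fo r x ∉ S) (hpS : ∀ j ∈ J, ∀ r ∈ R, ∀ x ∈ X, fp j r x ∉ S)
    (hop : ∀ r ∈ R, ∀ x ∈ X, ∀ j ∈ J, ∀ r' ∈ R, ∀ x' ∈ X, fo r x ≠ fp j r' x')
    (hoo : ∀ r ∈ R, ∀ x ∈ X, ∀ r' ∈ R, ∀ x' ∈ X, fo r x = fo r' x' → r = r' ∧ x = x')
    (hcap : S.card + 2 ≤ H) (μ : Fin M → ℝ) :
    ∃ μ', runInstrs H (sumUp fp fo J R X) ⟨μ, resident S μ⟩ = some ⟨μ', resident S μ'⟩ ∧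
      (∀ a, (∀ r ∈ R, ∀ x ∈ X, fo r x ≠ a) → μ' a = μ a) ∧
      ∀ r ∈ R, ∀ x ∈ X, μ' (fo r x) = ∑ j ∈ J, μ (fp j r x) := by
  set κ := resident S μ with hκ
  have hcard : (supp κ).card ≤ S.card := card_supp_resident_le _ _
  set μ₁ : Fin M → ℝ := fun a => if a ∈ blockAddrs fo R X then 0 else μ a with hμ₁
  have hμ₁o : ∀ r ∈ R, ∀ x ∈ X, μ₁ (fo r x) = 0 := by
    intro r hr x hx
    have : fo r x ∈ blockAddrs fo R X := mem_blockAddrs.2 ⟨r, hr, x, hx, rfl⟩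
    simp only [hμ₁, this, if_true]
  have hμ₁z : ∀ a, (∀ r ∈ R, ∀ x ∈ X, fo r x ≠ a) → μ₁ a = μ a := by
    intro a ha
    have : a ∉ blockAddrs fo R X := by
      rw [mem_blockAddrs]
      rintro ⟨r, hr, x, hx, e⟩
      exact ha r hr x hx e
    simp only [hμ₁, this, if_false]
  set Z : Set (Fin M) := {a | ∀ r ∈ R, ∀ x ∈ X, fo r x ≠ a} with hZ
  have hpZ : ∀ j ∈ J, ∀ r ∈ R, ∀ x ∈ X, fp j r x ∈ Z := fun j hj r hr x hx r' hr' x' hx' =>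
    hop r' hr' x' hx' j hj r hr x hx
  have h3 : Adds H κ Z μ₁ (forEach X fun x => forEach R fun r => addUp (fo r x) J fun j => fp j r x)
      (∑ x ∈ X, ∑ r ∈ R, Pi.single (fo r x) (∑ j ∈ J, μ₁ (fp j r x))) := by
    refine Adds.forEach fun x hx => Adds.forEach fun r hr => Adds.addUp
      (fun h => h r hr x hx rfl) (resident_of_notMem (hoS r hr x hx) _) (by omega)
      (fun j hj => hpZ j hj r hr x hx) fun j hj => resident_of_notMem (hpS j hj r hr x hx) _
  have hres : κ = resident S (μ₁ + ∑ x ∈ X, ∑ r ∈ R,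
      Pi.single (fo r x) (∑ j ∈ J, μ₁ (fp j r x))) := by
    refine resident_congr fun a ha => ?_
    have : a ∈ Z := fun r hr x hx e => hoS r hr x hx (e ▸ ha)
    rw [Pi.add_apply, h3.zero _ this, hμ₁z _ this, add_zero]
  refine ⟨μ₁ + ∑ x ∈ X, ∑ r ∈ R, Pi.single (fo r x) (∑ j ∈ J, μ₁ (fp j r x)), ?_, ?_, ?_⟩
  · rw [← hres]
    refine runInstrs_append_of (runInstrs_zeros _ _ _ (by omega) ?_) (h3.run μ₁ fun _ _ => rfl)
    intro a ha
    obtain ⟨r, hr, x, hx, rfl⟩ := mem_blockAddrs.1 ha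
    exact resident_of_notMem (hoS r hr x hx) _
  · intro a ha
    rw [Pi.add_apply, h3.zero a ha, hμ₁z a ha, add_zero]
  · intro r hr x hx
    rw [Pi.add_apply, hμ₁o r hr x hx, zero_add, sum_single_apply hoo _ hr hx]
    exact Finset.sum_congr rfl fun j hj => by rw [hμ₁z _ (hpZ j hj r hr x hx)]

/-! #### Exchange of messages -/

open Classical in
/-- The exchange in which the message `τ` brings the word at address `sa τ` of processor `src τ` to
the address `da τ` of processor `dst τ`. -/
noncomputable def recvOf {ι T : Type} (msgs : Finset T) (dst : T → ι) (da : T → Fin M)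
    (src : T → ι) (sa : T → Fin M) : ι → Fin M → Option (ι × Fin M) := fun P a =>
  if h : ∃ τ ∈ msgs, dst τ = P ∧ da τ = a then some (src h.choose, sa h.choose) else none

section

variable {ι T : Type} {msgs : Finset T} {dst : T → ι} {da : T → Fin M} {src : T → ι}
  {sa : T → Fin M}

/-- When no two messages have the same target, the message chosen in `recvOf` is forced. -/
theorem recvOf_of_mem
    (hinj : ∀ τ ∈ msgs, ∀ τ' ∈ msgs, dst τ = dst τ' → da τ = da τ' → τ = τ') {τ : T}
    (hτ : τ ∈ msgs) : recvOf msgs dst da src sa (dst τ) (da τ) = some (src τ, sa τ) := by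
  have h : ∃ τ' ∈ msgs, dst τ' = dst τ ∧ da τ' = da τ := ⟨τ, hτ, rfl, rfl⟩
  have e : h.choose = τ := hinj _ h.choose_spec.1 _ hτ h.choose_spec.2.1 h.choose_spec.2.2
  rw [recvOf, dif_pos h, e]

theorem recvOf_of_not {P : ι} {a : Fin M} (h : ∀ τ ∈ msgs, dst τ = P → da τ ≠ a) :
    recvOf msgs dst da src sa P a = none := by
  rw [recvOf, dif_neg]
  rintro ⟨τ, hτ, h1, h2⟩
  exact h τ hτ h1 h2

theorem deliver_recvOf_of_mem
    (hinj : ∀ τ ∈ msgs, ∀ τ' ∈ msgs, dst τ = dst τ' → da τ = da τ' → τ = τ')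
    (σ : ι → LocalState M) {τ : T} (hτ : τ ∈ msgs) :
    (deliver (recvOf msgs dst da src sa) σ (dst τ)).mem (da τ) = (σ (src τ)).mem (sa τ) := by
  simp [deliver, recvOf_of_mem hinj hτ]

theorem deliver_recvOf_of_not (σ : ι → LocalState M) {P : ι} {a : Fin M}
    (h : ∀ τ ∈ msgs, dst τ = P → da τ ≠ a) :
    (deliver (recvOf msgs dst da src sa) σ P).mem a = (σ P).mem a := by
  simp [deliver, recvOf_of_not h]

/-- An exchange invalidates cached copies of overwritten words. No message is addressed to a
resident word, so the cache stays an exact copy. -/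
theorem deliver_recvOf_cache (σ : ι → LocalState M) {P : ι} {S : Finset (Fin M)}
    (hσ : (σ P).cache = resident S (σ P).mem) (h : ∀ τ ∈ msgs, dst τ = P → da τ ∉ S) :
    (deliver (recvOf msgs dst da src sa) σ P).cache =
      resident S (deliver (recvOf msgs dst da src sa) σ P).mem := by
  funext a
  by_cases ha : a ∈ S
  · have h' : ∀ τ ∈ msgs, dst τ = P → da τ ≠ a := fun τ hτ hP e => h τ hτ hP (e ▸ ha)
    rw [resident_of_mem ha, deliver_recvOf_of_not σ h']
    simp [deliver, recvOf_of_not h', hσ, resident_of_mem ha]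
  · rw [resident_of_notMem ha]
    simp only [deliver]
    split
    · rw [hσ, resident_of_notMem ha]
    · rfl

/-- Every transfer comes from a message, and its target determines which message was chosen; this
bounds both the received and the sent words. -/
theorem words_recvOf_le [Fintype ι] [DecidableEq ι] (instrs : ι → List (Instr M)) (P : ι) :
    (⟨instrs, recvOf msgs dst da src sa⟩ : Superstep ι M).words P ≤
      (msgs.filter fun τ => dst τ = P).card + (msgs.filter fun τ => src τ = P).card := by
  classical
  refine add_le_add ?_ ?_
  · refine (Finset.card_le_card (t := (msgs.filter fun τ => dst τ = P).image da) ?_).trans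
      Finset.card_image_le
    intro a ha
    by_contra hn
    have h0 : recvOf msgs dst da src sa P a = none := recvOf_of_not fun τ hτ hP e =>
      hn (Finset.mem_image.2 ⟨τ, Finset.mem_filter.2 ⟨hτ, hP⟩, e⟩)
    simp [h0] at ha
  · refine (Finset.card_le_card
      (t := (msgs.filter fun τ => src τ = P).image fun τ => (dst τ, da τ)) ?_).trans
      Finset.card_image_le
    rintro ⟨R, a⟩ hd
    have hd := (Finset.mem_filter.1 hd).2
    simp only [recvOf] at hd
    split_ifs at hd with h
    · simp only [Option.map_some, Option.some.injEq] at hd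
      exact Finset.mem_image.2 ⟨h.choose, Finset.mem_filter.2 ⟨h.choose_spec.1, hd⟩,
        Prod.ext h.choose_spec.2.1 h.choose_spec.2.2⟩
    · simp at hd

end

/-- A run exists if every superstep leads from one invariant to the next. -/
theorem Program.exists_isRun {ι : Type} (prog : Program ι M) {H : ℕ}
    (Inv : ℕ → (ι → LocalState M) → Prop)
    (hstep : ∀ u σ, Inv u σ → ∃ τ, (prog.step u).Exec H σ τ ∧ Inv (u + 1) τ)
    {σ₀ : ι → LocalState M} (h₀ : Inv 0 σ₀) :
    ∃ σ : ℕ → ι → LocalState M, σ 0 = σ₀ ∧ prog.IsRun H σ ∧ ∀ u, Inv u (σ u) := by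
  choose f hf using hstep
  let σ : (u : ℕ) → {τ : ι → LocalState M // Inv u τ} := fun u =>
    Nat.rec ⟨σ₀, h₀⟩ (fun u τ => ⟨f u τ.1 τ.2, (hf u τ.1 τ.2).2⟩) u
  exact ⟨fun u => (σ u).1, rfl, fun u _ => (hf u (σ u).1 (σ u).2).1, fun u => (σ u).2⟩

/-- Charging every superstep at the same bound loses only a constant factor here, since the
iteration count already enters through `prog.S`. -/
theorem Program.F_le {ι : Type} [Fintype ι] (prog : Program ι M) {b : ℕ}
    (h : ∀ u P, (prog.step u).flops P ≤ b) : prog.F ≤ prog.S * b := by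
  have := Finset.sum_le_card_nsmul (Finset.range prog.S)
    (fun u => Finset.univ.sup fun P => (prog.step u).flops P) b
    fun u _ => Finset.sup_le fun P _ => h u P
  rwa [Finset.card_range, smul_eq_mul] at this

theorem Program.W_le {ι : Type} [Fintype ι] [DecidableEq ι] (prog : Program ι M) {b : ℕ}
    (h : ∀ u P, (prog.step u).words P ≤ b) : prog.W ≤ prog.S * b := by
  have := Finset.sum_le_card_nsmul (Finset.range prog.S)
    (fun u => Finset.univ.sup fun P => (prog.step u).words P) b
    fun u _ => Finset.sup_le fun P _ => h u P
  rwa [Finset.card_range, smul_eq_mul] at this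

theorem Program.Q_le {ι : Type} [Fintype ι] (prog : Program ι M) {b : ℕ}
    (h : ∀ u P, (prog.step u).traffic P ≤ b) : prog.Q ≤ prog.S * b := by
  have := Finset.sum_le_card_nsmul (Finset.range prog.S)
    (fun u => Finset.univ.sup fun P => (prog.step u).traffic P) b
    fun u _ => Finset.sup_le fun P _ => h u P
  rwa [Finset.card_range, smul_eq_mul] at this

end BSP

namespace StreamingMM

/-! ### Columns of `B`, their blocks and pieces -/

section Columns

variable (q c w : ℕ) {k : ℕ}

/-- The number of the piece of the column `x` in its block. -/
def sub [NeZero q] (x : Fin k) : Fin q := Fin.ofNat q (piece q c w x)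

/-- The layer that treats the column `x`. -/
def lay [NeZero c] (x : Fin k) : Fin c := Fin.ofNat c (piece q c w x / q)

/-- The iteration that treats the column `x`. -/
def iter (x : Fin k) : ℕ := piece q c w x / q / c

/-- The position of the column `x` in a buffer for a block. -/
def blockSlot (x : Fin k) : Fin (k / (w * c) + 1) := Fin.ofNat _ x.val

/-- The position of the column `x` in a buffer for a piece. -/
def pieceSlot (x : Fin k) : Fin (k / (w * c * q) + 1) := Fin.ofNat _ x.val

variable {q c w}

/-- Division with remainder by `c`: block `l + t * c` with `l < c` has remainder `l` and quotient
`t`. -/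
theorem inBlock_iff [NeZero c] {l : Fin c} {t : ℕ} {x : Fin k} :
    InBlock q c w (l.val + t * c) x ↔ lay q c w x = l ∧ iter q c w x = t := by
  have hc : 0 < c := Nat.pos_of_ne_zero (NeZero.ne c)
  simp only [InBlock, lay, iter, Fin.ext_iff, Fin.val_ofNat]
  constructor
  · intro h
    rw [h, Nat.add_mul_mod_self_right, Nat.mod_eq_of_lt l.isLt, Nat.add_mul_div_right _ _ hc,
      Nat.div_eq_of_lt l.isLt, zero_add]
    exact ⟨rfl, rfl⟩
  · rintro ⟨h1, h2⟩
    rw [← h1, ← h2, Nat.mod_add_div']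

theorem inPiece_iff [NeZero q] [NeZero c] {l : Fin c} {t : ℕ} {i : Fin q} {x : Fin k} :
    InPiece q c w (l.val + t * c) i x ↔
      (lay q c w x = l ∧ iter q c w x = t) ∧ sub q c w x = i := by
  rw [InPiece, inBlock_iff]
  simp [sub, Fin.ext_iff]

theorem iter_lt [NeZero q] [NeZero c] [NeZero w] (x : Fin k) : iter q c w x < w := by
  have hq : 0 < q := Nat.pos_of_ne_zero (NeZero.ne q)
  have hc : 0 < c := Nat.pos_of_ne_zero (NeZero.ne c)
  have hw : 0 < w := Nat.pos_of_ne_zero (NeZero.ne w)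
  have hk : 0 < k := x.pos
  rw [iter, piece, Nat.div_div_eq_div_mul, Nat.div_div_eq_div_mul, Nat.div_lt_iff_lt_mul
    (by positivity)]
  have h : x.val * (w * c * q) < k * (w * c * q) := Nat.mul_lt_mul_of_pos_right x.isLt (by positivity)
  calc _ < _ := h
    _ = _ := by ring

/-- Two members of one of the `Z` even parts of `k` columns differ by at most `k / Z`, so residues
modulo `k / Z + 1` separate them. This makes the residue a valid buffer position that can be reused
in every iteration. -/
theorem eq_of_part_eq {Z x x' : ℕ} (hk : 0 < k) (hZ : 0 < Z) (h : x * Z / k = x' * Z / k)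
    (hmod : x % (k / Z + 1) = x' % (k / Z + 1)) : x = x' := by
  wlog hle : x ≤ x' generalizing x x'
  · exact (this h.symm hmod.symm (by omega)).symm
  obtain ⟨d, rfl⟩ := Nat.exists_eq_add_of_le hle
  have h1 : x * Z / k * k ≤ x * Z := Nat.div_mul_le_self _ _
  have h2 : (x + d) * Z < (x + d) * Z / k * k + k := Nat.lt_div_mul_add hk
  rw [← h] at h2
  have h3 : d * Z < k := by nlinarith
  have h4 : d ≤ k / Z := (Nat.le_div_iff_mul_le hZ).2 h3.le
  have h5 : (k / Z + 1) ∣ d := by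
    have := (Nat.modEq_iff_dvd' hle).1 hmod
    simpa using this
  have := Nat.eq_zero_of_dvd_of_lt h5 (by omega)
  omega

/-- The numbers `iter`, `lay` and `sub` are the digits of `piece` in mixed radix, so together they
determine the piece. -/
theorem eq_of_pieceSlot_eq [NeZero q] [NeZero c] [NeZero w] {x x' : Fin k}
    (hs : sub q c w x = sub q c w x') (hl : lay q c w x = lay q c w x')
    (hi : iter q c w x = iter q c w x') (h : pieceSlot q c w x = pieceSlot q c w x') : x = x' := by
  have hZ : 0 < w * c * q := Nat.pos_of_ne_zero (mul_ne_zero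
    (mul_ne_zero (NeZero.ne w) (NeZero.ne c)) (NeZero.ne q))
  simp only [sub, lay, iter, pieceSlot, Fin.ext_iff, Fin.val_ofNat] at hs hl hi h
  have h1 : piece q c w x / q = piece q c w x' / q := by
    rw [← Nat.div_add_mod (piece q c w x / q) c, hl, hi, Nat.div_add_mod]
  have h2 : piece q c w x = piece q c w x' := by
    rw [← Nat.div_add_mod (piece q c w x) q, hs, h1, Nat.div_add_mod]
  exact Fin.ext (eq_of_part_eq x.pos hZ h2 h)

theorem eq_of_blockSlot_eq [NeZero q] [NeZero c] [NeZero w] {x x' : Fin k}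
    (hl : lay q c w x = lay q c w x') (hi : iter q c w x = iter q c w x')
    (h : blockSlot c w x = blockSlot c w x') : x = x' := by
  have hq : 0 < q := Nat.pos_of_ne_zero (NeZero.ne q)
  have hZ : 0 < w * c := Nat.pos_of_ne_zero (mul_ne_zero (NeZero.ne w) (NeZero.ne c))
  simp only [lay, iter, blockSlot, Fin.ext_iff, Fin.val_ofNat] at hl hi h
  have h1 : piece q c w x / q = piece q c w x' / q := by
    rw [← Nat.div_add_mod (piece q c w x / q) c, hl, hi, Nat.div_add_mod]
  -- Grouping `q` consecutive pieces is the same as cutting the columns into `w * c` parts: the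
  -- factor `q` cancels between the nested floors.
  simp only [piece, Nat.div_div_eq_div_mul, ← mul_assoc _ _ q, Nat.mul_div_mul_right _ _ hq] at h1
  exact Fin.ext (eq_of_part_eq x.pos hZ (by simpa only [mul_assoc] using h1) h)

/-- The columns that layer `l` treats in iteration `t`. -/
def blockCols (q c w k : ℕ) [NeZero c] (l : Fin c) (t : ℕ) : Finset (Fin k) :=
  Finset.univ.filter fun x => lay q c w x = l ∧ iter q c w x = t

/-- The columns of the piece `i` of the block that layer `l` treats in iteration `t`. -/
def pieceCols (q c w k : ℕ) [NeZero q] [NeZero c] (l : Fin c) (t : ℕ) (i : Fin q) :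
    Finset (Fin k) :=
  Finset.univ.filter fun x => (lay q c w x = l ∧ iter q c w x = t) ∧ sub q c w x = i

/-- The columns of the piece `i` of any block that layer `l` treats. -/
def layerCols (q c w k : ℕ) [NeZero q] [NeZero c] (l : Fin c) (i : Fin q) : Finset (Fin k) :=
  Finset.univ.filter fun x => lay q c w x = l ∧ sub q c w x = i

@[simp] theorem mem_blockCols [NeZero c] {l : Fin c} {t : ℕ} {x : Fin k} :
    x ∈ blockCols q c w k l t ↔ lay q c w x = l ∧ iter q c w x = t := by
  simp [blockCols]

@[simp] theorem mem_pieceCols [NeZero q] [NeZero c] {l : Fin c} {t : ℕ} {i : Fin q} {x : Fin k} :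
    x ∈ pieceCols q c w k l t i ↔ (lay q c w x = l ∧ iter q c w x = t) ∧ sub q c w x = i := by
  simp [pieceCols]

@[simp] theorem mem_layerCols [NeZero q] [NeZero c] {l : Fin c} {i : Fin q} {x : Fin k} :
    x ∈ layerCols q c w k l i ↔ lay q c w x = l ∧ sub q c w x = i := by
  simp [layerCols]

variable [NeZero q] [NeZero c] [NeZero w]

theorem card_blockCols_le (l : Fin c) (t : ℕ) :
    (blockCols q c w k l t).card ≤ k / (w * c) + 1 := by
  have h := Finset.card_le_card_of_injOn (t := Finset.univ) (s := blockCols q c w k l t)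
    (blockSlot c w) (fun _ _ => Finset.mem_coe.2 (Finset.mem_univ _)) ?_
  · simpa using h
  · intro x hx y hy hxy
    have hx := mem_blockCols.1 (Finset.mem_coe.1 hx)
    have hy := mem_blockCols.1 (Finset.mem_coe.1 hy)
    exact eq_of_blockSlot_eq (hx.1.trans hy.1.symm) (hx.2.trans hy.2.symm) hxy

theorem card_pieceCols_le (l : Fin c) (t : ℕ) (i : Fin q) :
    (pieceCols q c w k l t i).card ≤ k / (w * c * q) + 1 := by
  have h := Finset.card_le_card_of_injOn (t := Finset.univ) (s := pieceCols q c w k l t i)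
    (pieceSlot q c w) (fun _ _ => Finset.mem_coe.2 (Finset.mem_univ _)) ?_
  · simpa using h
  · intro x hx y hy hxy
    have hx := mem_pieceCols.1 (Finset.mem_coe.1 hx)
    have hy := mem_pieceCols.1 (Finset.mem_coe.1 hy)
    exact eq_of_pieceSlot_eq (hx.2.trans hy.2.symm) (hx.1.1.trans hy.1.1.symm)
      (hx.1.2.trans hy.1.2.symm) hxy

/-- A processor receives one piece per iteration, and a column is identified by its iteration and
its position in the piece. -/
theorem card_layerCols_le (l : Fin c) (i : Fin q) :
    (layerCols q c w k l i).card ≤ w * (k / (w * c * q) + 1) := by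
  have h := Finset.card_le_card_of_injOn (t := Finset.range w ×ˢ Finset.univ)
    (s := layerCols q c w k l i) (fun x => (iter q c w x, pieceSlot q c w x))
    (fun x _ => by simp [iter_lt]) ?_
  · simpa using h
  · intro x hx y hy hxy
    have hx := mem_layerCols.1 (Finset.mem_coe.1 hx)
    have hy := mem_layerCols.1 (Finset.mem_coe.1 hy)
    exact eq_of_pieceSlot_eq (hx.2.trans hy.2.symm) (hx.1.trans hy.1.symm)
      (Prod.ext_iff.1 hxy).1 (Prod.ext_iff.1 hxy).2

end Columns

/-! ### Memory layout -/

/-- The uses of words of main memory: entries of `A` and `B`, of the redistributed `B`, of a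
gathered block of `B`, of a product of blocks, of pieces of such products that were received from
other processors, and of `C`. -/
inductive Slot (m n k q b d : ℕ) where
  | A (r : Fin m) (y : Fin n)
  | B (y : Fin n) (x : Fin k)
  | redist (y : Fin n) (x : Fin k)
  | gather (y : Fin n) (u : Fin b)
  | product (r : Fin m) (u : Fin b)
  | recv (j : Fin q) (r : Fin m) (u : Fin d)
  | C (r : Fin m) (x : Fin k)

variable {m n k q c M : ℕ}

namespace Layout

/-- The rows of the `i`-th block. -/
def rowSet (L : Layout m n k q c M) (i : Fin q) : Finset (Fin m) :=
  Finset.univ.filter fun r => L.rowBlk r = i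

/-- The columns of the `j`-th block. -/
def colSet (L : Layout m n k q c M) (j : Fin q) : Finset (Fin n) :=
  Finset.univ.filter fun y => L.colBlk y = j

theorem card_rowSet (L : Layout m n k q c M) (i : Fin q) : (L.rowSet i).card = L.rows i := rfl

theorem card_colSet (L : Layout m n k q c M) (j : Fin q) : (L.colSet j).card = L.cols j := rfl

@[simp] theorem mem_rowSet {L : Layout m n k q c M} {i : Fin q} {r : Fin m} :
    r ∈ L.rowSet i ↔ L.rowBlk r = i := by
  simp [rowSet]

@[simp] theorem mem_colSet {L : Layout m n k q c M} {j : Fin q} {y : Fin n} :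
    y ∈ L.colSet j ↔ L.colBlk y = j := by
  simp [colSet]

/-- The slots that processor `P` uses. -/
def Uses [NeZero q] [NeZero c] (L : Layout m n k q c M) (w : ℕ) {b d : ℕ} (P : Proc q c) :
    Slot m n k q b d → Prop
  | .A r y => L.rowBlk r = P.1 ∧ L.colBlk y = P.2.1
  | .B y x => L.owner y x = P
  | .redist y x => L.colBlk y = P.2.1 ∧ lay q c w x = P.2.2 ∧ sub q c w x = P.1
  | .gather y _ => L.colBlk y = P.2.1
  | .product r _ => L.rowBlk r = P.1
  | .recv _ r _ => L.rowBlk r = P.1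
  | .C r x => L.rowBlk r = P.1 ∧ lay q c w x = P.2.2 ∧ sub q c w x = P.2.1

end Layout

/-- Addresses for all slots, at which `A` and `B` are where the layout says. -/
structure Addresses [NeZero q] [NeZero c] (L : Layout m n k q c M) (w b d : ℕ) where
  adr : Proc q c → Slot m n k q b d → Fin M
  inj : ∀ P, Set.InjOn (adr P) {s | L.Uses w P s}
  adr_A : ∀ P r y, adr P (.A r y) = L.loc P (Sum.inl (r, y))
  adr_B : ∀ P y x, adr P (.B y x) = L.loc P (Sum.inr (y, x))

/-- The addresses of `A` and `B` are prescribed by the layout. The remaining words of memory are at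
least as many as the other slots in use, so these embed injectively, wherever the inputs lie. -/
theorem Addresses.nonempty [NeZero q] [NeZero c] [NeZero M] (L : Layout m n k q c M)
    (w : ℕ) [NeZero w] (b d : ℕ)
    (hM : ∀ P : Proc q c, L.rows P.1 * L.cols P.2.1 + L.owned P +
      (L.cols P.2.1 * (w * (k / (w * c * q) + 1)) + L.cols P.2.1 * b + L.rows P.1 * b +
        q * (L.rows P.1 * d) + L.rows P.1 * (w * (k / (w * c * q) + 1))) ≤ M) :
    Nonempty (Addresses L w b d) := by
  classical
  have key : ∀ P : Proc q c, ∃ f : Slot m n k q b d → Fin M, Set.InjOn f {s | L.Uses w P s} ∧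
      (∀ r y, f (.A r y) = L.loc P (Sum.inl (r, y))) ∧
      ∀ y x, f (.B y x) = L.loc P (Sum.inr (y, x)) := by
    intro P
    set old : Finset (Fin m × Fin n ⊕ Fin n × Fin k) :=
      (L.rowSet P.1 ×ˢ L.colSet P.2.1).disjSum
        (Finset.univ.filter fun e : Fin n × Fin k => L.owner e.1 e.2 = P) with hold
    have hcard_old : old.card = L.rows P.1 * L.cols P.2.1 + L.owned P := by
      rw [hold, Finset.card_disjSum, Finset.card_product]
      rfl
    set free : Finset (Fin M) := (old.image (L.loc P))ᶜ with hfree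
    have hcard_free : M ≤ free.card + (L.rows P.1 * L.cols P.2.1 + L.owned P) := by
      rw [hfree, Finset.card_compl, Fintype.card_fin, ← hcard_old]
      have := Finset.card_image_le (s := old) (f := L.loc P)
      omega
    set new : Finset (Slot m n k q b d) :=
      (L.colSet P.2.1 ×ˢ layerCols q c w k P.2.2 P.1).image (fun e => .redist e.1 e.2) ∪
      (L.colSet P.2.1 ×ˢ Finset.univ).image (fun e => .gather e.1 e.2) ∪
      (L.rowSet P.1 ×ˢ Finset.univ).image (fun e => .product e.1 e.2) ∪
      (Finset.univ ×ˢ L.rowSet P.1 ×ˢ Finset.univ).image (fun e => .recv e.1 e.2.1 e.2.2) ∪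
      (L.rowSet P.1 ×ˢ layerCols q c w k P.2.2 P.2.1).image (fun e => .C e.1 e.2) with hnew
    have hcard_new : new.card ≤ L.cols P.2.1 * (w * (k / (w * c * q) + 1)) + L.cols P.2.1 * b +
        L.rows P.1 * b + q * (L.rows P.1 * d) + L.rows P.1 * (w * (k / (w * c * q) + 1)) := by
      refine (Finset.card_union_le _ _).trans (add_le_add ((Finset.card_union_le _ _).trans
        (add_le_add ((Finset.card_union_le _ _).trans (add_le_add ((Finset.card_union_le _ _).trans
        (add_le_add ?_ ?_)) ?_)) ?_)) ?_) <;> refine Finset.card_image_le.trans ?_ <;>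
        simp only [Finset.card_product, Finset.card_univ, Fintype.card_fin, L.card_rowSet,
          L.card_colSet, le_refl]
      · exact Nat.mul_le_mul_left _ (card_layerCols_le _ _)
      · exact Nat.mul_le_mul_left _ (card_layerCols_le _ _)
    have hle : Fintype.card new ≤ Fintype.card free := by
      simp only [Fintype.card_coe]
      have := hM P
      omega
    obtain ⟨e⟩ := Function.Embedding.nonempty_of_card_le hle
    -- The value 0 is a dummy for slots that the processor does not use.
    let g : Slot m n k q b d → Fin M := fun s => if h : s ∈ new then (e ⟨s, h⟩).val else 0
    have hg : ∀ s ∈ new, g s ∈ free := by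
      intro s hs
      simp only [g, hs, dif_pos]
      exact (e ⟨s, hs⟩).2
    have hg_inj : ∀ s ∈ new, ∀ s' ∈ new, g s = g s' → s = s' := by
      intro s hs s' hs' h
      simp only [g, hs, hs', dif_pos] at h
      simpa using e.injective (Subtype.ext h)
    let f : Slot m n k q b d → Fin M := fun s => match s with
      | .A r y => L.loc P (Sum.inl (r, y))
      | .B y x => L.loc P (Sum.inr (y, x))
      | s => g s
    have hcase : ∀ s, L.Uses w P s → (∃ o ∈ old, f s = L.loc P o ∧
        s = Sum.elim (fun a => .A a.1 a.2) (fun a => .B a.1 a.2) o) ∨ (s ∈ new ∧ f s = g s) := by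
      intro s hs
      cases s with
      | A r y =>
        exact Or.inl ⟨Sum.inl (r, y), by simpa [hold, Layout.Uses] using hs, rfl, rfl⟩
      | B y x =>
        exact Or.inl ⟨Sum.inr (y, x), by simpa [hold, Layout.Uses] using hs, rfl, rfl⟩
      | redist y x => exact Or.inr ⟨by simpa [hnew, Layout.Uses] using hs, rfl⟩
      | gather y u => exact Or.inr ⟨by simpa [hnew, Layout.Uses] using hs, rfl⟩
      | product r u => exact Or.inr ⟨by simpa [hnew, Layout.Uses] using hs, rfl⟩
      | recv j r u => exact Or.inr ⟨by simpa [hnew, Layout.Uses] using hs, rfl⟩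
      | C r x => exact Or.inr ⟨by simpa [hnew, Layout.Uses] using hs, rfl⟩
    have hloc : ∀ o ∈ old, L.loc P o ∉ free := by
      intro o ho h
      exact (Finset.mem_compl.1 h) (Finset.mem_image_of_mem _ ho)
    have hloc_inj : ∀ o ∈ old, ∀ o' ∈ old, L.loc P o = L.loc P o' → o = o' := by
      have hmem : ∀ o ∈ old, o ∈ {e | Sum.elim
          (fun a : Fin m × Fin n => L.rowBlk a.1 = P.1 ∧ L.colBlk a.2 = P.2.1)
          (fun b : Fin n × Fin k => L.owner b.1 b.2 = P) e} := by
        rintro (o | o) ho <;> simpa [hold] using ho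
      exact fun o ho o' ho' h => L.loc_inj P (hmem o ho) (hmem o' ho') h
    refine ⟨f, ?_, fun _ _ => rfl, fun _ _ => rfl⟩
    intro s hs s' hs' h
    rcases hcase s hs with ⟨o, ho, h1, h2⟩ | ⟨ho, h1⟩ <;>
      rcases hcase s' hs' with ⟨o', ho', h1', h2'⟩ | ⟨ho', h1'⟩ <;> rw [h1, h1'] at h
    · rw [h2, h2', hloc_inj o ho o' ho' h]
    · exact absurd (h ▸ hg s' ho') (hloc o ho)
    · exact absurd (h.symm ▸ hg s ho) (hloc o' ho')
    · exact hg_inj s ho s' ho' h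
  choose f h1 h2 h3 using key
  exact ⟨⟨f, h1, h2, h3⟩⟩

/-! ### The permuted matrices -/

namespace Layout

theorem permA_apply (L : Layout m n k q c M) (A : Matrix (Fin m) (Fin n) ℝ) (r : Fin m)
    (y : Fin n) : L.permA A r y = A (L.P₁ r) (L.P₂.symm y) := by
  simp [permA, Equiv.Perm.permMatrix, PEquiv.toMatrix_toPEquiv_mul, PEquiv.mul_toMatrix_toPEquiv]

theorem permB_apply (L : Layout m n k q c M) (B : Matrix (Fin n) (Fin k) ℝ) (y : Fin n)
    (x : Fin k) : L.permB B y x = B (L.P₂.symm y) x := by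
  rw [permB, Equiv.Perm.permMatrix, ← PEquiv.toMatrix_symm, ← Equiv.toPEquiv_symm,
    PEquiv.toMatrix_toPEquiv_mul]
  rfl

/-- The columns of `A` and the rows of `B` are permuted alike, so the inner sum is only reindexed;
grouping it by the blocks of columns gives the partial products. -/
theorem permC_apply (L : Layout m n k q c M) (A : Matrix (Fin m) (Fin n) ℝ)
    (B : Matrix (Fin n) (Fin k) ℝ) (r : Fin m) (x : Fin k) :
    L.permC A B r x = ∑ j, L.partialC A B j r x := by
  have h1 : L.permC A B r x = ∑ y, L.permA A r y * L.permB B y x := by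
    rw [permC, Equiv.Perm.permMatrix, PEquiv.toMatrix_toPEquiv_mul]
    simp only [Matrix.submatrix_apply, id, Matrix.mul_apply, permA_apply, permB_apply]
    exact (Equiv.sum_comp L.P₂.symm fun y => A (L.P₁ r) y * B y x).symm
  rw [h1]
  exact (Finset.sum_fiberwise Finset.univ L.colBlk fun y => L.permA A r y * L.permB B y x).symm

end Layout

end StreamingMM

/-! ### The program and its invariants. -/

namespace StreamingMM

open BSP

variable {m n k q c M w : ℕ} [NeZero q] [NeZero c] [NeZero w] {L : Layout m n k q c M}

namespace Addresses

variable (ad : Addresses L w (k / (w * c) + 1) (k / (w * c * q) + 1))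

/-- The address of an entry of the local block of `P₁ A P₂`. -/
def locA (P : Proc q c) (r : Fin m) (y : Fin n) : Fin M := ad.adr P (.A r y)

/-- The address of an entry of a gathered block. -/
def locGather (P : Proc q c) (y : Fin n) (x : Fin k) : Fin M :=
  ad.adr P (.gather y (blockSlot c w x))

/-- The address of an entry of a product of blocks. -/
def locProduct (P : Proc q c) (r : Fin m) (x : Fin k) : Fin M :=
  ad.adr P (.product r (blockSlot c w x))

/-- The address of an entry of a product of blocks that was received from the `j`-th processor. -/
def locRecv (P : Proc q c) (j : Fin q) (r : Fin m) (x : Fin k) : Fin M :=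
  ad.adr P (.recv j r (pieceSlot q c w x))

/-- The address of an entry of `C`. -/
def locC (P : Proc q c) (r : Fin m) (x : Fin k) : Fin M := ad.adr P (.C r x)

/-- The addresses of the rows `R₀ P` of the local block of `P₁ A P₂`. -/
def kept (R₀ : Proc q c → Finset (Fin m)) (P : Proc q c) : Finset (Fin M) :=
  blockAddrs (ad.locA P) (R₀ P) (L.colSet P.2.1)

omit [NeZero w] in
theorem adr_inj {P : Proc q c} {s s' : Slot m n k q (k / (w * c) + 1) (k / (w * c * q) + 1)}
    (hs : L.Uses w P s) (hs' : L.Uses w P s') (h : ad.adr P s = ad.adr P s') : s = s' :=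
  ad.inj P hs hs' h

omit [NeZero w] in
theorem adr_ne {P : Proc q c} {s s' : Slot m n k q (k / (w * c) + 1) (k / (w * c * q) + 1)}
    (hs : L.Uses w P s) (hs' : L.Uses w P s') (h : s ≠ s') : ad.adr P s ≠ ad.adr P s' :=
  fun e => h (ad.inj P hs hs' e)

omit [NeZero w] in
theorem adr_notMem_kept {R₀ : Proc q c → Finset (Fin m)} (hR₀ : ∀ P, R₀ P ⊆ L.rowSet P.1)
    {P : Proc q c} {s : Slot m n k q (k / (w * c) + 1) (k / (w * c * q) + 1)}
    (hs : L.Uses w P s) (h : ∀ r y, Slot.A r y ≠ s) : ad.adr P s ∉ ad.kept R₀ P := by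
  rw [kept, mem_blockAddrs]
  rintro ⟨r, hr, y, hy, e⟩
  exact ad.adr_ne (s := .A r y) ⟨Layout.mem_rowSet.1 (hR₀ P hr), Layout.mem_colSet.1 hy⟩ hs
    (h r y) e

/-! #### The supersteps -/

/-- Redistribution of `B`. -/
noncomputable def redistStep (R₀ : Proc q c → Finset (Fin m)) : Superstep (Proc q c) M where
  instrs P := evicts (ad.kept R₀ P)ᶜ
  recv := recvOf (Finset.univ : Finset (Fin n × Fin k))
    (fun e => (sub q c w e.2, L.colBlk e.1, lay q c w e.2))
    (fun e => ad.adr (sub q c w e.2, L.colBlk e.1, lay q c w e.2) (.redist e.1 e.2))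
    (fun e => L.owner (L.P₂.symm e.1) e.2)
    (fun e => ad.adr (L.owner (L.P₂.symm e.1) e.2) (.B (L.P₂.symm e.1) e.2))

/-- Gathering of a block of `B`. -/
noncomputable def gatherStep (t : ℕ) : Superstep (Proc q c) M where
  instrs _ := []
  recv := recvOf (Finset.univ.filter fun e : Fin q × Fin n × Fin k => iter q c w e.2.2 = t)
    (fun e => (e.1, L.colBlk e.2.1, lay q c w e.2.2))
    (fun e => ad.locGather (e.1, L.colBlk e.2.1, lay q c w e.2.2) e.2.1 e.2.2)
    (fun e => (sub q c w e.2.2, L.colBlk e.2.1, lay q c w e.2.2))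
    (fun e => ad.adr (sub q c w e.2.2, L.colBlk e.2.1, lay q c w e.2.2) (.redist e.2.1 e.2.2))

/-- Multiplication of blocks, and exchange of pieces of the products. -/
noncomputable def computeStep (R₀ : Proc q c → Finset (Fin m)) (s t : ℕ) :
    Superstep (Proc q c) M where
  instrs P := multiply (ad.locA P) (ad.locGather P) (ad.locProduct P) (blockCols q c w k P.2.2 t) s
    (L.rowSet P.1) (R₀ P) (L.colSet P.2.1)
  recv := recvOf (Finset.univ.filter fun e : Fin q × Fin m × Fin k => iter q c w e.2.2 = t)
    (fun e => (L.rowBlk e.2.1, sub q c w e.2.2, lay q c w e.2.2))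
    (fun e => ad.locRecv (L.rowBlk e.2.1, sub q c w e.2.2, lay q c w e.2.2) e.1 e.2.1 e.2.2)
    (fun e => (L.rowBlk e.2.1, e.1, lay q c w e.2.2))
    (fun e => ad.locProduct (L.rowBlk e.2.1, e.1, lay q c w e.2.2) e.2.1 e.2.2)

/-- Summation of the received pieces. -/
noncomputable def sumStep (t : ℕ) : Superstep (Proc q c) M where
  instrs P := sumUp (ad.locRecv P) (ad.locC P) Finset.univ (L.rowSet P.1)
    (pieceCols q c w k P.2.2 t P.2.1)
  recv _ _ := none

/-- The supersteps of the program. -/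
noncomputable def step (R₀ : Proc q c → Finset (Fin m)) (s : ℕ) : ℕ → Superstep (Proc q c) M
  | 0 => ad.redistStep R₀
  | v + 1 => if v % 3 = 0 then ad.gatherStep (v / 3) else
      if v % 3 = 1 then ad.computeStep R₀ s (v / 3) else ad.sumStep (v / 3)

/-- The program for streaming matrix multiplication, where processor `P` keeps the rows `R₀ P`
of its block of `P₁ A P₂` in cache and treats the other rows by tiles of size at most `s × s`. -/
noncomputable def program (R₀ : Proc q c → Finset (Fin m)) (s : ℕ) : Program (Proc q c) M where
  S := 3 * w + 1
  step := ad.step R₀ s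

/-! #### Correctness -/

/-- What holds after the redistribution when `t` iterations are complete. -/
structure Ready (R₀ : Proc q c → Finset (Fin m)) (A : Matrix (Fin m) (Fin n) ℝ)
    (B : Matrix (Fin n) (Fin k) ℝ) (t : ℕ) (σ : Proc q c → LocalState M) : Prop where
  cache : ∀ P, (σ P).cache = resident (ad.kept R₀ P) (σ P).mem
  memA : ∀ P : Proc q c, ∀ r y, L.rowBlk r = P.1 → L.colBlk y = P.2.1 →
    (σ P).mem (ad.locA P r y) = L.permA A r y
  memB : ∀ P : Proc q c, ∀ y x, L.Uses w P
    (.redist y x : Slot m n k q (k / (w * c) + 1) (k / (w * c * q) + 1)) →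
    (σ P).mem (ad.adr P (.redist y x)) = L.permB B y x
  memC : ∀ P : Proc q c, ∀ r x, L.Uses w P
    (.C r x : Slot m n k q (k / (w * c) + 1) (k / (w * c * q) + 1)) → iter q c w x < t →
    (σ P).mem (ad.locC P r x) = L.permC A B r x

/-- The blocks of `B` for iteration `t` are gathered. -/
def Gathered (B : Matrix (Fin n) (Fin k) ℝ) (t : ℕ) (σ : Proc q c → LocalState M) : Prop :=
  ∀ P : Proc q c, ∀ y x, L.colBlk y = P.2.1 → lay q c w x = P.2.2 → iter q c w x = t →
    (σ P).mem (ad.locGather P y x) = L.permB B y x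

/-- The products of blocks for iteration `t` are computed, and their pieces are exchanged. -/
structure Computed (A : Matrix (Fin m) (Fin n) ℝ) (B : Matrix (Fin n) (Fin k) ℝ) (t : ℕ)
    (σ : Proc q c → LocalState M) : Prop where
  product : ∀ P : Proc q c, ∀ r x, L.rowBlk r = P.1 → lay q c w x = P.2.2 → iter q c w x = t →
    (σ P).mem (ad.locProduct P r x) = L.partialC A B P.2.1 r x
  recv : ∀ P : Proc q c, ∀ j r x, L.rowBlk r = P.1 → lay q c w x = P.2.2 → sub q c w x = P.2.1 →
    iter q c w x = t → (σ P).mem (ad.locRecv P j r x) = L.partialC A B j r x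

section

variable {ad} {R₀ : Proc q c → Finset (Fin m)} {A : Matrix (Fin m) (Fin n) ℝ}
  {B : Matrix (Fin n) (Fin k) ℝ} {σ : Proc q c → LocalState M} {H : ℕ}

-- The evictions remove arbitrary initial cache contents and leave only the kept entries of `A`.
-- Each entry of the permuted `B` then goes straight from its owner to the one processor responsible
-- for its row block and piece.
omit [NeZero w] in
theorem exec_redistStep (hR₀ : ∀ P, R₀ P ⊆ L.rowSet P.1) (hσ : L.IsStart H A B σ)
    (hcache : ∀ P, ∀ a ∈ ad.kept R₀ P, (σ P).cache a = some ((σ P).mem a)) :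
    ∃ τ, (ad.redistStep R₀).Exec H σ τ ∧ ad.Ready R₀ A B 0 τ := by
  set ρ : Proc q c → LocalState M := fun P =>
    ⟨(σ P).mem, fun a => if a ∈ (ad.kept R₀ P)ᶜ then none else (σ P).cache a⟩ with hρ
  refine ⟨_, ⟨ρ, fun P => runInstrs_evicts _ _ _, rfl⟩, ?_⟩
  dsimp only [redistStep]
  have hρc : ∀ P, (ρ P).cache = resident (ad.kept R₀ P) (ρ P).mem := by
    intro P
    funext a
    by_cases ha : a ∈ ad.kept R₀ P
    · simp [hρ, ha, resident_of_mem, hcache P a ha]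
    · simp [hρ, ha, resident_of_notMem]
  refine ⟨fun P => deliver_recvOf_cache ρ (hρc P) ?_, fun P r y hr hy => ?_,
    fun P y x hx => ?_, fun P r x _ h => absurd h (Nat.not_lt_zero _)⟩
  · rintro ⟨y, x⟩ _ rfl
    exact ad.adr_notMem_kept hR₀ ⟨rfl, rfl, rfl⟩ (by simp)
  · refine (deliver_recvOf_of_not ρ ?_).trans ?_
    · rintro ⟨y', x⟩ _ rfl
      exact ad.adr_ne ⟨rfl, rfl, rfl⟩ ⟨hr, hy⟩ (by simp)
    · exact (congrArg (σ P).mem (ad.adr_A P r y)).trans ((hσ P).2.1 r y hr hy)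
  · obtain ⟨i, j, l⟩ := P
    obtain ⟨rfl, rfl, rfl⟩ := hx
    refine (deliver_recvOf_of_mem ?_ ρ (Finset.mem_univ (y, x))).trans ?_
    -- Messages do not collide: with equal target processors both `redist` slots are used there, and
    -- addresses of used slots are distinct.
    · rintro ⟨y, x⟩ _ ⟨y', x'⟩ _ h1 h2
      rw [h1] at h2
      have h3 : L.Uses w (sub q c w x', L.colBlk y', lay q c w x')
          (.redist y x : Slot m n k q (k / (w * c) + 1) (k / (w * c * q) + 1)) := by
        simpa [Layout.Uses, and_comm, and_left_comm, and_assoc] using h1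
      have := ad.adr_inj h3 (s' := .redist y' x') ⟨rfl, rfl, rfl⟩ h2
      simpa using this
    · rw [L.permB_apply, ← (hσ _).2.2 _ _ rfl]
      exact congrArg (σ _).mem (ad.adr_B _ _ _)

/-- Only `gather` slots are overwritten, so `Ready` persists. Their positions are residues, but all
messages belong to iteration `t`, where the residues separate the columns of a block. -/
theorem exec_gatherStep (hR₀ : ∀ P, R₀ P ⊆ L.rowSet P.1) {t : ℕ} (hσ : ad.Ready R₀ A B t σ) :
    ∃ τ, (ad.gatherStep t).Exec H σ τ ∧ ad.Ready R₀ A B t τ ∧ ad.Gathered B t τ := by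
  refine ⟨_, ⟨σ, fun P => rfl, rfl⟩, ?_⟩
  dsimp only [gatherStep]
  refine ⟨⟨fun P => deliver_recvOf_cache σ (hσ.cache P) ?_,
    fun P r y hr hy => ?_, fun P y x hx => ?_, fun P r x hx ht => ?_⟩, fun P y x hy hl ht => ?_⟩
  · rintro ⟨i, y, x⟩ _ rfl
    exact ad.adr_notMem_kept hR₀ (s := .gather y _) rfl (by simp)
  · refine (deliver_recvOf_of_not σ ?_).trans (hσ.memA P r y hr hy)
    rintro ⟨i, y', x⟩ _ rfl
    exact ad.adr_ne (s := .gather y' _) rfl ⟨hr, hy⟩ (by simp)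
  · refine (deliver_recvOf_of_not σ ?_).trans (hσ.memB P y x hx)
    rintro ⟨i, y', x'⟩ _ rfl
    exact ad.adr_ne (s := .gather y' _) rfl hx (by simp)
  · refine (deliver_recvOf_of_not σ ?_).trans (hσ.memC P r x hx ht)
    rintro ⟨i, y', x'⟩ _ rfl
    exact ad.adr_ne (s := .gather y' _) rfl hx (by simp)
  · obtain ⟨i, j, l⟩ := P
    obtain rfl : L.colBlk y = j := hy
    obtain rfl : lay q c w x = l := hl
    refine (deliver_recvOf_of_mem (τ := (i, y, x)) ?_ σ
      (Finset.mem_filter.2 ⟨Finset.mem_univ _, ht⟩)).trans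
      (hσ.memB (sub q c w x, L.colBlk y, lay q c w x) y x ⟨rfl, rfl, rfl⟩)
    rintro ⟨i, y, x⟩ h ⟨i', y', x'⟩ h' h1 h2
    have h := (Finset.mem_filter.1 h).2
    have h' := (Finset.mem_filter.1 h').2
    simp only [Prod.mk.injEq] at h1
    obtain ⟨rfl, h3, h4⟩ := h1
    simp only [h3, h4] at h2
    have := ad.adr_inj (P := (i, L.colBlk y', lay q c w x')) (s := .gather y _)
      (s' := .gather y' _) h3 rfl h2
    simp only [Slot.gather.injEq] at this
    rw [this.1, eq_of_blockSlot_eq h4 (h.trans h'.symm) this.2]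

/-- The multiplication writes only `product` slots and the exchange only `recv` slots. The local
products thus survive the exchange, and both halves of `Computed` hold after one superstep. -/
theorem exec_computeStep (hR₀ : ∀ P, R₀ P ⊆ L.rowSet P.1) {s : ℕ} (hs : 0 < s)
    (hcap₀ : ∀ P, R₀ P = ∅ ∨ (R₀ P).card * L.cols P.2.1 + L.cols P.2.1 + 1 ≤ H)
    (hcap : ∀ P, (R₀ P).card * L.cols P.2.1 + s * s + s + 1 ≤ H) {t : ℕ}
    (hσ : ad.Ready R₀ A B t σ) (hσ' : ad.Gathered B t σ) :
    ∃ τ, (ad.computeStep R₀ s t).Exec H σ τ ∧ ad.Ready R₀ A B t τ ∧ ad.Computed A B t τ := by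
  have hrun : ∀ P, ∃ μ', runInstrs H ((ad.computeStep R₀ s t).instrs P) (σ P) =
        some ⟨μ', resident (ad.kept R₀ P) μ'⟩ ∧
      (∀ a, (∀ r ∈ L.rowSet P.1, ∀ x ∈ blockCols q c w k P.2.2 t, ad.locProduct P r x ≠ a) →
        μ' a = (σ P).mem a) ∧
      ∀ r ∈ L.rowSet P.1, ∀ x ∈ blockCols q c w k P.2.2 t,
        μ' (ad.locProduct P r x) = ∑ y ∈ L.colSet P.2.1,
          (σ P).mem (ad.locA P r y) * (σ P).mem (ad.locGather P y x) := by
    intro P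
    have h := runInstrs_multiply (H := H) (fa := ad.locA P) (fb := ad.locGather P)
      (fc := ad.locProduct P) (X := blockCols q c w k P.2.2 t) (Y := L.colSet P.2.1) hs (hR₀ P)
      ?_ ?_ ?_ ?_ ?_ (hcap₀ P) (hcap P) (σ P).mem
    · rw [show resident (blockAddrs (ad.locA P) (R₀ P) (L.colSet P.2.1)) (σ P).mem = (σ P).cache
        from (hσ.cache P).symm] at h
      exact h
    · simp only [Layout.mem_rowSet, Layout.mem_colSet]
      exact fun r hr x _ r' hr' y hy => ad.adr_ne (s := .product r _) hr ⟨hr', hy⟩ (by simp)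
    · simp only [Layout.mem_rowSet, Layout.mem_colSet]
      exact fun r hr x _ y hy x' _ =>
        ad.adr_ne (s := .product r _) (s' := .gather y _) hr hy (by simp)
    · simp only [Layout.mem_rowSet, Layout.mem_colSet]
      exact fun r hr y hy y' hy' x _ =>
        ad.adr_ne (s := .A r y) (s' := .gather y' _) ⟨hr, hy⟩ hy' (by simp)
    · simp only [Layout.mem_rowSet, Layout.mem_colSet]
      intro r hr y hy r' hr' y' hy' e
      have := ad.adr_inj (s := .A r y) (s' := .A r' y') ⟨hr, hy⟩ ⟨hr', hy'⟩ e
      simp only [Slot.A.injEq] at this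
      exact this.1
    · simp only [Layout.mem_rowSet, mem_blockCols]
      intro r hr x hx r' hr' x' hx' e
      have := ad.adr_inj (s := .product r _) (s' := .product r' _) hr hr' e
      simp only [Slot.product.injEq] at this
      exact ⟨this.1, eq_of_blockSlot_eq (hx.1.trans hx'.1.symm) (hx.2.trans hx'.2.symm) this.2⟩
  choose μ' hrun hframe hval using hrun
  have hval' : ∀ P : Proc q c, ∀ r x, L.rowBlk r = P.1 → lay q c w x = P.2.2 →
      iter q c w x = t → μ' P (ad.locProduct P r x) = L.partialC A B P.2.1 r x := by
    intro P r x hr hl ht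
    rw [hval P r (Layout.mem_rowSet.2 hr) x (mem_blockCols.2 ⟨hl, ht⟩)]
    refine Finset.sum_congr rfl fun y hy => ?_
    have hy := Layout.mem_colSet.1 hy
    rw [hσ.memA P r y hr hy, hσ' P y x hy hl ht]
  have hframe' : ∀ (P : Proc q c) (s : Slot m n k q (k / (w * c) + 1) (k / (w * c * q) + 1)),
      L.Uses w P s → (∀ r u, Slot.product r u ≠ s) → μ' P (ad.adr P s) = (σ P).mem (ad.adr P s) :=
    fun P s hs h => hframe P _ fun r hr x _ =>
      ad.adr_ne (s := .product r _) (Layout.mem_rowSet.1 hr) hs (h _ _)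
  set ρ : Proc q c → LocalState M := fun P => ⟨μ' P, resident (ad.kept R₀ P) (μ' P)⟩ with hρ
  have hframe'' : ∀ (P : Proc q c) (a : Slot m n k q (k / (w * c) + 1) (k / (w * c * q) + 1)),
      L.Uses w P a → (∀ j r u, Slot.recv j r u ≠ a) →
      (deliver (ad.computeStep R₀ s t).recv ρ P).mem (ad.adr P a) = μ' P (ad.adr P a) := by
    intro P a hs h
    dsimp only [computeStep]
    refine deliver_recvOf_of_not ρ ?_
    rintro ⟨j, r, x⟩ _ rfl
    exact ad.adr_ne (s := .recv j r _) rfl hs (h _ _ _)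
  refine ⟨deliver (ad.computeStep R₀ s t).recv ρ, ⟨ρ, hrun, rfl⟩, ?_⟩
  dsimp only [computeStep] at hframe'' ⊢
  refine ⟨⟨fun P => deliver_recvOf_cache ρ rfl ?_,
    fun P r y hr hy => ?_, fun P y x hx => ?_, fun P r x hx ht => ?_⟩,
    ⟨fun P r x hr hl ht => ?_, fun P j r x hr hl hsub ht => ?_⟩⟩
  · rintro ⟨j, r, x⟩ _ rfl
    exact ad.adr_notMem_kept hR₀ (s := .recv j r _) rfl (by simp)
  · rw [← hσ.memA P r y hr hy]
    exact (hframe'' P (.A r y) ⟨hr, hy⟩ (by simp)).trans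
      (hframe' P (.A r y) ⟨hr, hy⟩ (by simp))
  · rw [← hσ.memB P y x hx]
    exact (hframe'' P _ hx (by simp)).trans (hframe' P _ hx (by simp))
  · rw [← hσ.memC P r x hx ht]
    exact (hframe'' P _ hx (by simp)).trans (hframe' P _ hx (by simp))
  · rw [← hval' P r x hr hl ht]
    exact hframe'' P (.product r _) hr (by simp)
  · obtain ⟨i, j', l⟩ := P
    obtain rfl : L.rowBlk r = i := hr
    obtain rfl : sub q c w x = j' := hsub
    obtain rfl : lay q c w x = l := hl
    refine (deliver_recvOf_of_mem (τ := (j, r, x)) ?_ ρ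
      (Finset.mem_filter.2 ⟨Finset.mem_univ _, ht⟩)).trans
      (hval' (L.rowBlk r, j, lay q c w x) r x rfl rfl ht)
    rintro ⟨j, r, x⟩ h ⟨j', r', x'⟩ h' h1 h2
    have h := (Finset.mem_filter.1 h).2
    have h' := (Finset.mem_filter.1 h').2
    simp only [Prod.mk.injEq] at h1
    obtain ⟨h3, h4, h5⟩ := h1
    simp only [h3, h4, h5] at h2
    have := ad.adr_inj (P := (L.rowBlk r', sub q c w x', lay q c w x')) (s := .recv j r _)
      (s' := .recv j' r' _) h3 rfl h2
    simp only [Slot.recv.injEq] at this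
    rw [this.1, this.2.1, eq_of_pieceSlot_eq h4 h5 (h.trans h'.symm) this.2.2]

-- The superstep completes the reduce-scatter by a purely local sum over `j`. It writes only entries
-- of `C` from iteration `t`, so the results of earlier iterations persist.
omit [NeZero w] in
theorem exec_sumStep (hR₀ : ∀ P, R₀ P ⊆ L.rowSet P.1)
    (hcap : ∀ P, (R₀ P).card * L.cols P.2.1 + 2 ≤ H) {t : ℕ}
    (hσ : ad.Ready R₀ A B t σ) (hσ' : ad.Computed A B t σ) :
    ∃ τ, (ad.sumStep t).Exec H σ τ ∧ ad.Ready R₀ A B (t + 1) τ := by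
  have hrun : ∀ P, ∃ μ', runInstrs H ((ad.sumStep t).instrs P) (σ P) =
        some ⟨μ', resident (ad.kept R₀ P) μ'⟩ ∧
      (∀ a, (∀ r ∈ L.rowSet P.1, ∀ x ∈ pieceCols q c w k P.2.2 t P.2.1, ad.locC P r x ≠ a) →
        μ' a = (σ P).mem a) ∧
      ∀ r ∈ L.rowSet P.1, ∀ x ∈ pieceCols q c w k P.2.2 t P.2.1,
        μ' (ad.locC P r x) = ∑ j, (σ P).mem (ad.locRecv P j r x) := by
    intro P
    have h := runInstrs_sumUp (H := H) (S := ad.kept R₀ P) (fp := ad.locRecv P) (fo := ad.locC P)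
      (J := Finset.univ) (R := L.rowSet P.1) (X := pieceCols q c w k P.2.2 t P.2.1)
      ?_ ?_ ?_ ?_ ?_ (σ P).mem
    · rw [← hσ.cache P] at h
      exact h
    · simp only [Layout.mem_rowSet, mem_pieceCols]
      exact fun r hr x hx => ad.adr_notMem_kept hR₀ (s := .C r x) ⟨hr, hx.1.1, hx.2⟩ (by simp)
    · simp only [Layout.mem_rowSet]
      exact fun j _ r hr x _ => ad.adr_notMem_kept hR₀ (s := .recv j r _) hr (by simp)
    · simp only [Layout.mem_rowSet, mem_pieceCols]
      exact fun r hr x hx j _ r' hr' x' _ => ad.adr_ne (s := .C r x) (s' := .recv j r' _)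
        ⟨hr, hx.1.1, hx.2⟩ hr' (by simp)
    · simp only [Layout.mem_rowSet, mem_pieceCols]
      intro r hr x hx r' hr' x' hx' e
      have := ad.adr_inj (s := .C r x) (s' := .C r' x') ⟨hr, hx.1.1, hx.2⟩ ⟨hr', hx'.1.1, hx'.2⟩ e
      simpa using this
    · exact (Nat.add_le_add_right (card_blockAddrs_le _ _ _) 2).trans (hcap P)
  choose μ' hrun hframe hval using hrun
  have hframe' : ∀ (P : Proc q c) (s : Slot m n k q (k / (w * c) + 1) (k / (w * c * q) + 1)),
      L.Uses w P s → (∀ r x, iter q c w x = t → Slot.C r x ≠ s) →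
      μ' P (ad.adr P s) = (σ P).mem (ad.adr P s) := by
    intro P s hs h
    refine hframe P _ fun r hr x hx => ?_
    have hx := mem_pieceCols.1 hx
    exact ad.adr_ne (s := .C r x) ⟨Layout.mem_rowSet.1 hr, hx.1.1, hx.2⟩ hs (h _ _ hx.1.2)
  refine ⟨fun P => ⟨μ' P, resident (ad.kept R₀ P) (μ' P)⟩, ⟨_, hrun, rfl⟩,
    ⟨fun P => rfl, fun P r y hr hy => ?_, fun P y x hx => ?_, fun P r x hx ht => ?_⟩⟩
  · rw [← hσ.memA P r y hr hy]
    exact hframe' P (.A r y) ⟨hr, hy⟩ (by simp)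
  · rw [← hσ.memB P y x hx]
    exact hframe' P _ hx (by simp)
  · rcases Nat.lt_succ_iff_lt_or_eq.1 ht with ht | ht
    · rw [← hσ.memC P r x hx ht]
      refine hframe' P _ hx fun r' x' ht' e => ?_
      simp only [Slot.C.injEq] at e
      rw [e.2] at ht'
      omega
    · obtain ⟨hr, hl, hsub⟩ := hx
      refine (hval P r (Layout.mem_rowSet.2 hr) x (mem_pieceCols.2 ⟨⟨hl, ht⟩, hsub⟩)).trans ?_
      rw [L.permC_apply]
      exact Finset.sum_congr rfl fun j _ => hσ'.recv P j r x hr hl hsub ht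

end

/-- The invariant of the program after `u` supersteps. -/
def Inv (R₀ : Proc q c → Finset (Fin m)) (H : ℕ) (A : Matrix (Fin m) (Fin n) ℝ)
    (B : Matrix (Fin n) (Fin k) ℝ) : ℕ → (Proc q c → LocalState M) → Prop
  | 0, σ => L.IsStart H A B σ ∧ ∀ P, ∀ a ∈ ad.kept R₀ P, (σ P).cache a = some ((σ P).mem a)
  | v + 1, σ => ad.Ready R₀ A B (v / 3) σ ∧ (v % 3 = 1 → ad.Gathered B (v / 3) σ) ∧
      (v % 3 = 2 → ad.Computed A B (v / 3) σ)

theorem executes {R₀ : Proc q c → Finset (Fin m)} (hR₀ : ∀ P, R₀ P ⊆ L.rowSet P.1) {s H : ℕ}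
    (hs : 0 < s) (hcap₀ : ∀ P, R₀ P = ∅ ∨ (R₀ P).card * L.cols P.2.1 + L.cols P.2.1 + 1 ≤ H)
    (hcap : ∀ P, (R₀ P).card * L.cols P.2.1 + s * s + s + 1 ≤ H) {warm : Prop}
    (hwarm : warm ∨ ∀ P, R₀ P = ∅) : Executes (ad.program R₀ s) L H w warm := by
  -- Superstep 0 redistributes, and iteration `t` occupies supersteps `3 * t + 1` to `3 * t + 3`;
  -- the schedule counts completed supersteps.
  refine ⟨⟨1, fun t => 3 * t + 2, fun t => 3 * t + 3, fun t => 3 * t + 4,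
    fun P y x => ad.adr P (.redist y x), fun _ => ad.locGather, fun _ => ad.locProduct, ad.locC⟩,
    ⟨fun t _ => ?_, fun t _ => ?_, fun t _ => ?_, fun t _ => ?_, fun t ht => ?_⟩,
    fun A B σ₀ h₀ hA => ?_⟩
  · change 1 < 3 * t + 2
    omega
  · change 3 * t + 2 < 3 * t + 3
    omega
  · change 3 * t + 3 < 3 * t + 4
    omega
  · change 3 * t + 4 ≤ 3 * (t + 1) + 2
    omega
  · change 3 * t + 4 ≤ 3 * w + 1
    omega
  have hstep : ∀ u σ, ad.Inv R₀ H A B u σ →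
      ∃ τ, ((ad.program R₀ s).step u).Exec H σ τ ∧ ad.Inv R₀ H A B (u + 1) τ := by
    -- The invariant is preserved for all `u`, also beyond the last superstep, so no bound on `u`
    -- has to be carried.
    rintro (_ | v) σ hσ
    · obtain ⟨τ, h1, h2⟩ := exec_redistStep hR₀ hσ.1 hσ.2
      exact ⟨τ, h1, h2, fun h => by simp at h, fun h => by simp at h⟩
    · obtain ⟨hv, hg, hc⟩ := hσ
      have h3 : v % 3 < 3 := Nat.mod_lt _ (by norm_num)
      obtain h | h | h : v % 3 = 0 ∨ v % 3 = 1 ∨ v % 3 = 2 := by omega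
      · obtain ⟨τ, h1, h2, h3⟩ := exec_gatherStep (H := H) hR₀ hv
        refine ⟨τ, by simpa [program, step, h] using h1, ?_⟩
        have e : (v + 1) / 3 = v / 3 := by omega
        refine ⟨by rwa [e], fun _ => by rwa [e], fun h => by omega⟩
      · obtain ⟨τ, h1, h2, h3⟩ := exec_computeStep hR₀ hs hcap₀ hcap hv (hg h)
        refine ⟨τ, by simpa [program, step, h] using h1, ?_⟩
        have e : (v + 1) / 3 = v / 3 := by omega
        refine ⟨by rwa [e], fun h => by omega, fun _ => by rwa [e]⟩
      · obtain ⟨τ, h1, h2⟩ := exec_sumStep (H := H) hR₀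
          (fun P => by have := hcap P; nlinarith) hv (hc h)
        refine ⟨τ, by simpa [program, step, h] using h1, ?_⟩
        have e : (v + 1) / 3 = v / 3 + 1 := by omega
        refine ⟨by rwa [e], fun h => by omega, fun h => by omega⟩
  have hinit : ad.Inv R₀ H A B 0 σ₀ := by
    refine ⟨h₀, fun P a ha => ?_⟩
    obtain ⟨r, hr, y, hy, rfl⟩ := mem_blockAddrs.1 ha
    -- In a warm start the cached entries of `A` agree with main memory; otherwise nothing is kept
    -- and there is nothing to check.
    rcases hwarm with hw | he
    · have hr := Layout.mem_rowSet.1 (hR₀ P hr)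
      have hy := Layout.mem_colSet.1 hy
      have e : ad.locA P r y = L.loc P (Sum.inl (r, y)) := ad.adr_A P r y
      rw [e, hA hw P r y hr hy, (h₀ P).2.1 r y hr hy]
    · simp [he P] at hr
  obtain ⟨σ, hσ₀, hrun, hσ⟩ := (ad.program R₀ s).exists_isRun _ hstep hinit
  have hready : ∀ t i, i < 3 → ad.Ready R₀ A B t (σ (3 * t + i + 1)) := by
    intro t i hi
    have := (hσ (3 * t + i + 1)).1
    rwa [show (3 * t + i) / 3 = t by omega] at this
  have hC : ∀ (t' : ℕ) (i j : Fin q) (l : Fin c), ∀ t < t', ∀ r x, L.rowBlk r = i →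
      InPiece q c w (l + t * c) j x →
      (σ (3 * t' + 1) (i, j, l)).mem (ad.locC (i, j, l) r x) = L.permC A B r x := by
    intro t' i j l t ht r x hr hx
    obtain ⟨⟨h1, h2⟩, h3⟩ := inPiece_iff.1 hx
    exact (hready t' 0 (by omega)).memC (i, j, l) r x ⟨hr, h1, h3⟩ (by omega)
  refine ⟨σ, hσ₀, hrun, ⟨fun i j l t ht y x hy hx => ?_, fun i j l t ht y x hy hx => ?_,
    fun i j l t ht r x hr hx => ?_, fun i j l t ht r x hr hx => ?_, hC w⟩⟩
  · obtain ⟨⟨h1, h2⟩, h3⟩ := inPiece_iff.1 hx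
    exact (hready 0 0 (by omega)).memB (i, j, l) y x ⟨hy, h1, h3⟩
  · obtain ⟨h1, h2⟩ := inBlock_iff.1 hx
    have h := (hσ (3 * t + 1 + 1)).2.1 (by omega)
    rw [show (3 * t + 1) / 3 = t by omega] at h
    exact h (i, j, l) y x hy h1 h2
  · obtain ⟨h1, h2⟩ := inBlock_iff.1 hx
    have h := (hσ (3 * t + 2 + 1)).2.2 (by omega)
    rw [show (3 * t + 2) / 3 = t by omega] at h
    exact h.product (i, j, l) r x hr h1 h2
  · exact hC (t + 1) i j l t (by omega) r x hr hx

end Addresses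

end StreamingMM

namespace StreamingMM

open BSP

/-! ### Costs -/

section Costs

variable {m n k q c M w : ℕ} [NeZero q] [NeZero c] [NeZero w] {L : Layout m n k q c M}

namespace Addresses

variable (ad : Addresses L w (k / (w * c) + 1) (k / (w * c * q) + 1))
  {R₀ : Proc q c → Finset (Fin m)} {rm cm om : ℕ}

theorem flops_step_le (hR₀ : ∀ P, R₀ P ⊆ L.rowSet P.1) (hr : ∀ i, L.rows i ≤ rm)
    (hc : ∀ j, L.cols j ≤ cm) (s u : ℕ) (P : Proc q c) :
    (ad.step R₀ s u).flops P ≤ rm * (k / (w * c) + 1) + 2 * (k / (w * c) + 1) * (rm * cm) +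
      rm * (k / (w * c * q) + 1) * (q + 1) := by
  rcases u with _ | v
  · exact (flopsOf_evicts _).le.trans (Nat.zero_le _)
  simp only [step]
  split_ifs
  · exact Nat.zero_le _
  · refine le_add_right ((flopsOf_multiply_le _ _ _ _ _ (hR₀ P) _).trans ?_)
    have h1 := card_blockCols_le (q := q) (w := w) (k := k) P.2.2 (v / 3)
    have h2 := hr P.1
    have h3 := hc P.2.1
    rw [L.card_rowSet, L.card_colSet]
    gcongr
  · refine le_add_left ((flopsOf_sumUp_le _ _ _ _ _).trans ?_)
    have h1 := card_pieceCols_le (q := q) (w := w) (k := k) P.2.2 (v / 3) P.2.1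
    have h2 := hr P.1
    rw [L.card_rowSet, Finset.card_univ, Fintype.card_fin]
    gcongr

theorem traffic_step_le (hr : ∀ i, L.rows i ≤ rm) {s b : ℕ}
    (hb : ∀ (P : Proc q c) (t : ℕ), trafficOf (multiply (ad.locA P) (ad.locGather P)
      (ad.locProduct P) (blockCols q c w k P.2.2 t) s (L.rowSet P.1) (R₀ P) (L.colSet P.2.1)) ≤ b)
    (u : ℕ) (P : Proc q c) :
    (ad.step R₀ s u).traffic P ≤ b + rm * (k / (w * c * q) + 1) * (q + 3) := by
  rcases u with _ | v
  · exact (trafficOf_evicts _).le.trans (Nat.zero_le _)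
  simp only [step]
  split_ifs
  · exact Nat.zero_le _
  · exact le_add_right (hb P _)
  · refine le_add_left ((trafficOf_sumUp_le _ _ _ _ _).trans ?_)
    have h1 := card_pieceCols_le (q := q) (w := w) (k := k) P.2.2 (v / 3) P.2.1
    have h2 := hr P.1
    rw [L.card_rowSet, Finset.card_univ, Fintype.card_fin]
    gcongr

/-- Each column is treated by a single layer, so an entry of `B` is sent exactly once and a
processor sends no more words than it owns. -/
theorem words_redistStep_le (hc : ∀ j, L.cols j ≤ cm) (ho : ∀ P, L.owned P ≤ om) (P : Proc q c) :
    (ad.redistStep R₀).words P ≤ cm * (w * (k / (w * c * q) + 1)) + om := by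
  refine (words_recvOf_le _ P).trans (add_le_add ?_ ?_)
  · refine (Finset.card_le_card (t := L.colSet P.2.1 ×ˢ layerCols q c w k P.2.2 P.1) ?_).trans ?_
    · rintro ⟨y, x⟩ he
      obtain rfl := (Finset.mem_filter.1 he).2
      simp
    · rw [Finset.card_product]
      exact Nat.mul_le_mul (hc _) (card_layerCols_le _ _)
  · refine le_trans ?_ (ho P)
    refine Finset.card_le_card_of_injOn (fun e => (L.P₂.symm e.1, e.2)) ?_ ?_
    · rintro ⟨y, x⟩ he
      simpa using (Finset.mem_filter.1 he).2
    · rintro ⟨y, x⟩ _ ⟨y', x'⟩ _ h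
      simpa using h

theorem words_gatherStep_le (hc : ∀ j, L.cols j ≤ cm) (t : ℕ) (P : Proc q c) :
    (ad.gatherStep t).words P ≤
      cm * (k / (w * c) + 1) + q * (cm * (k / (w * c * q) + 1)) := by
  refine (words_recvOf_le _ P).trans (add_le_add ?_ ?_)
  · refine (Finset.card_le_card
      (t := {P.1} ×ˢ L.colSet P.2.1 ×ˢ blockCols q c w k P.2.2 t) ?_).trans ?_
    · rintro ⟨i, y, x⟩ he
      obtain ⟨he, rfl⟩ := Finset.mem_filter.1 he
      simpa using he
    · rw [Finset.card_product, Finset.card_product, Finset.card_singleton, one_mul]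
      exact Nat.mul_le_mul (hc _) (card_blockCols_le _ _)
  · refine (Finset.card_le_card
      (t := Finset.univ ×ˢ L.colSet P.2.1 ×ˢ pieceCols q c w k P.2.2 t P.1) ?_).trans ?_
    · rintro ⟨i, y, x⟩ he
      obtain ⟨he, rfl⟩ := Finset.mem_filter.1 he
      simpa using he
    · rw [Finset.card_product, Finset.card_product, Finset.card_univ, Fintype.card_fin]
      exact Nat.mul_le_mul_left _ (Nat.mul_le_mul (hc _) (card_pieceCols_le _ _ _))

theorem words_computeStep_le (hr : ∀ i, L.rows i ≤ rm) (s t : ℕ) (P : Proc q c) :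
    (ad.computeStep R₀ s t).words P ≤
      q * (rm * (k / (w * c * q) + 1)) + rm * (k / (w * c) + 1) := by
  refine (words_recvOf_le _ P).trans (add_le_add ?_ ?_)
  · refine (Finset.card_le_card
      (t := Finset.univ ×ˢ L.rowSet P.1 ×ˢ pieceCols q c w k P.2.2 t P.2.1) ?_).trans ?_
    · rintro ⟨j, r, x⟩ he
      obtain ⟨he, rfl⟩ := Finset.mem_filter.1 he
      simpa using he
    · rw [Finset.card_product, Finset.card_product, Finset.card_univ, Fintype.card_fin]
      exact Nat.mul_le_mul_left _ (Nat.mul_le_mul (hr _) (card_pieceCols_le _ _ _))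
  · refine (Finset.card_le_card
      (t := {P.2.1} ×ˢ L.rowSet P.1 ×ˢ blockCols q c w k P.2.2 t) ?_).trans ?_
    · rintro ⟨j, r, x⟩ he
      obtain ⟨he, rfl⟩ := Finset.mem_filter.1 he
      simpa using he
    · rw [Finset.card_product, Finset.card_product, Finset.card_singleton, one_mul]
      exact Nat.mul_le_mul (hr _) (card_blockCols_le _ _)

theorem words_step_le (hr : ∀ i, L.rows i ≤ rm) (hc : ∀ j, L.cols j ≤ cm)
    (ho : ∀ P, L.owned P ≤ om) (s u : ℕ) (P : Proc q c) :
    (ad.step R₀ s u).words P ≤ (cm * (w * (k / (w * c * q) + 1)) + om) +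
      (cm * (k / (w * c) + 1) + q * (cm * (k / (w * c * q) + 1))) +
      (q * (rm * (k / (w * c * q) + 1)) + rm * (k / (w * c) + 1)) := by
  rcases u with _ | v
  · exact le_add_right (le_add_right (ad.words_redistStep_le hc ho P))
  simp only [step]
  split_ifs
  · exact le_add_right (le_add_left (ad.words_gatherStep_le hc _ P))
  · exact le_add_left (ad.words_computeStep_le hr s _ P)
  · simp [Superstep.words, sumStep]

/-- The factor 4 comes from `3 * w + 1 ≤ 4 * w`. -/
theorem time_program_le {s bF bW bQ : ℕ} (hF : ∀ u P, (ad.step R₀ s u).flops P ≤ bF)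
    (hW : ∀ u P, (ad.step R₀ s u).words P ≤ bW) (hQ : ∀ u P, (ad.step R₀ s u).traffic P ≤ bQ)
    {γ β ν α : ℝ} (hγ : 0 ≤ γ) (hβ : 0 ≤ β) (hν : 0 ≤ ν) (hα : 0 ≤ α) :
    (ad.program R₀ s).time γ β ν α ≤ 4 * (w * (γ * bF + β * bW + ν * bQ + α)) := by
  have hw : 1 ≤ w := Nat.one_le_iff_ne_zero.2 (NeZero.ne w)
  have hS : (ad.program R₀ s).S ≤ 4 * w := by
    change 3 * w + 1 ≤ 4 * w
    omega
  have h1 : ((ad.program R₀ s).F : ℝ) ≤ 4 * w * bF := by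
    exact_mod_cast ((ad.program R₀ s).F_le hF).trans (Nat.mul_le_mul_right _ hS)
  have h2 : ((ad.program R₀ s).W : ℝ) ≤ 4 * w * bW := by
    exact_mod_cast ((ad.program R₀ s).W_le hW).trans (Nat.mul_le_mul_right _ hS)
  have h3 : ((ad.program R₀ s).Q : ℝ) ≤ 4 * w * bQ := by
    exact_mod_cast ((ad.program R₀ s).Q_le hQ).trans (Nat.mul_le_mul_right _ hS)
  have h4 : ((ad.program R₀ s).S : ℝ) ≤ 4 * w := by exact_mod_cast hS
  calc (ad.program R₀ s).time γ β ν α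
      ≤ γ * (4 * w * bF) + β * (4 * w * bW) + ν * (4 * w * bQ) + α * (4 * w) := by
        unfold Program.time
        gcongr
    _ = _ := by ring

end Addresses

/-- Traffic of a multiplication for which at most three rows are not kept in cache. -/
theorem trafficOf_multiply_kept_le {ρ η ξ : Type*} [DecidableEq ρ] [DecidableEq η]
    (fa : ρ → η → Fin M) (fb : η → ξ → Fin M) (fc : ρ → ξ → Fin M) {X : Finset ξ} {R R₀ : Finset ρ}
    {Y : Finset η} (hR₀ : R₀ ⊆ R) (h3 : (R \ R₀).card ≤ 3) {b rm cm : ℕ} (hb : 1 ≤ b)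
    (hX : X.card ≤ b) (hR : R.card ≤ rm) (hY : Y.card ≤ cm) :
    trafficOf (multiply fa fb fc X 1 R R₀ Y) ≤ 3 * (rm * b) + 14 * (cm * b) := by
  have h := trafficOf_multiply_le fa fb fc X 1 R R₀ Y
  have hcard := Finset.card_sdiff_add_card_eq_card hR₀
  rw [Nat.div_one, Nat.div_one] at h
  have h0 : (if R₀ = ∅ then 0 else X.card * (Y.card + 2 * R₀.card)) ≤
      X.card * (Y.card + 2 * R₀.card) := by
    split_ifs
    · exact Nat.zero_le _
    · exact le_rfl
  have h1 : R.card * X.card ≤ rm * b := Nat.mul_le_mul hR hX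
  have h2 : Y.card * X.card ≤ cm * b := Nat.mul_le_mul hY hX
  -- Loading the rows that are not kept is not proportional to the number of columns `X`; `1 ≤ b`
  -- lets it be charged to the gathered block. The 14 below is 3 + 3 * 3 + 2.
  have h4 : (R \ R₀).card * Y.card ≤ 3 * (cm * b) :=
    Nat.mul_le_mul h3 (hY.trans (Nat.le_mul_of_pos_right _ hb))
  have h5 : (R \ R₀).card * (Y.card * X.card) ≤ 3 * (Y.card * X.card) := Nat.mul_le_mul_right _ h3
  rw [← hcard] at h h1
  calc _ ≤ _ := h
    _ ≤ ((R \ R₀).card + R₀.card) * X.card + X.card * (Y.card + 2 * R₀.card) +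
        ((R \ R₀).card * Y.card + X.card * (Y.card * ((R \ R₀).card + 1) +
          2 * ((R \ R₀).card * (Y.card + 1)))) := by rw [hcard]; gcongr
    _ = 3 * (((R \ R₀).card + R₀.card) * X.card) + (R \ R₀).card * Y.card +
        3 * ((R \ R₀).card * (Y.card * X.card)) + 2 * (Y.card * X.card) := by ring
    _ ≤ _ := by omega

/-- Traffic of a multiplication for which no rows are kept in cache. -/
theorem trafficOf_multiply_empty_le {ρ η ξ : Type*} [DecidableEq ρ] [DecidableEq η]
    (fa : ρ → η → Fin M) (fb : η → ξ → Fin M) (fc : ρ → ξ → Fin M) {X : Finset ξ} {s : ℕ}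
    {R : Finset ρ} {Y : Finset η} {b rm cm : ℕ} (hX : X.card ≤ b) (hR : R.card ≤ rm)
    (hY : Y.card ≤ cm) :
    trafficOf (multiply fa fb fc X s R ∅ Y) ≤
      rm * b + rm * cm + b * (cm * (rm / s + 1) + 2 * (rm * (cm / s + 1))) := by
  have h := trafficOf_multiply_le fa fb fc X s R ∅ Y
  rw [if_pos rfl, Finset.sdiff_empty, add_zero] at h
  refine h.trans ?_
  rw [add_assoc]
  gcongr

end Costs

/-! ### Estimates -/

theorem cast_div_add_one_le {k Z : ℕ} (hZ : 0 < Z) (h : Z ≤ k) :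
    ((k / Z + 1 : ℕ) : ℝ) ≤ 2 * (k / Z) := by
  have h1 : ((k / Z : ℕ) : ℝ) ≤ k / Z := Nat.cast_div_le
  have h2 : (1 : ℝ) ≤ k / Z := by
    rw [one_le_div (by exact_mod_cast hZ)]
    exact_mod_cast h
  push_cast
  linarith

/-- Bounds on the sizes of the blocks. -/
structure Sizes (K m n k q c w : ℝ) (rm cm om bm pm : ℝ) : Prop where
  one_le : 1 ≤ K
  m_nonneg : 0 ≤ m
  n_nonneg : 0 ≤ n
  k_nonneg : 0 ≤ k
  q_pos : 0 < q
  c_pos : 0 < c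
  w_pos : 0 < w
  w_le : w ≤ q
  one_le_q : 1 ≤ q
  rm_nonneg : 0 ≤ rm
  cm_nonneg : 0 ≤ cm
  bm_nonneg : 0 ≤ bm
  pm_nonneg : 0 ≤ pm
  rm_le : rm ≤ K * (m / q)
  cm_le : cm ≤ K * (n / q)
  om_le : om ≤ K * (n * k / (q * q * c))
  bm_le : bm ≤ 2 * (k / (w * c))
  pm_le : pm ≤ 2 * (k / (w * c * q))

namespace Sizes

variable {K m n k q c w rm cm om bm pm : ℝ}

theorem rm_bm (h : Sizes K m n k q c w rm cm om bm pm) :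
    rm * bm ≤ 2 * K * (m * k / (w * (q * c))) := by
  obtain ⟨hK, hm, hn, hk, hq, hc, hw, hwq, hq1, hr0, hc0, hb0, hp0, hr, hcm, ho, hb, hp⟩ := h
  calc rm * bm ≤ (K * (m / q)) * (2 * (k / (w * c))) := by gcongr
    _ = _ := by field_simp

theorem cm_bm (h : Sizes K m n k q c w rm cm om bm pm) :
    cm * bm ≤ 2 * K * (n * k / (w * (q * c))) := by
  obtain ⟨hK, hm, hn, hk, hq, hc, hw, hwq, hq1, hr0, hc0, hb0, hp0, hr, hcm, ho, hb, hp⟩ := h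
  calc cm * bm ≤ (K * (n / q)) * (2 * (k / (w * c))) := by gcongr
    _ = _ := by field_simp

theorem q_rm_pm (h : Sizes K m n k q c w rm cm om bm pm) :
    q * (rm * pm) ≤ 2 * K * (m * k / (w * (q * c))) := by
  obtain ⟨hK, hm, hn, hk, hq, hc, hw, hwq, hq1, hr0, hc0, hb0, hp0, hr, hcm, ho, hb, hp⟩ := h
  calc q * (rm * pm) ≤ q * ((K * (m / q)) * (2 * (k / (w * c * q)))) := by gcongr
    _ = _ := by field_simp

theorem q_cm_pm (h : Sizes K m n k q c w rm cm om bm pm) :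
    q * (cm * pm) ≤ 2 * K * (n * k / (w * (q * c))) := by
  obtain ⟨hK, hm, hn, hk, hq, hc, hw, hwq, hq1, hr0, hc0, hb0, hp0, hr, hcm, ho, hb, hp⟩ := h
  calc q * (cm * pm) ≤ q * ((K * (n / q)) * (2 * (k / (w * c * q)))) := by gcongr
    _ = _ := by field_simp

theorem rm_pm (h : Sizes K m n k q c w rm cm om bm pm) :
    rm * pm ≤ 2 * K * (m * k / (w * (q * c))) :=
  (le_mul_of_one_le_left (mul_nonneg h.rm_nonneg h.pm_nonneg) h.one_le_q).trans h.q_rm_pm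

/-- By `w ≤ q`, storage for `w` pieces, one per iteration, is no larger than for the `q` pieces of a
single block. -/
theorem rm_w_pm (h : Sizes K m n k q c w rm cm om bm pm) :
    rm * (w * pm) ≤ 2 * K * (m * k / (w * (q * c))) := by
  refine le_trans ?_ h.q_rm_pm
  calc rm * (w * pm) = w * (rm * pm) := by ring
    _ ≤ _ := mul_le_mul_of_nonneg_right h.w_le (mul_nonneg h.rm_nonneg h.pm_nonneg)

theorem cm_w_pm (h : Sizes K m n k q c w rm cm om bm pm) :
    cm * (w * pm) ≤ 2 * K * (n * k / (w * (q * c))) := by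
  refine le_trans ?_ h.q_cm_pm
  calc cm * (w * pm) = w * (cm * pm) := by ring
    _ ≤ _ := mul_le_mul_of_nonneg_right h.w_le (mul_nonneg h.cm_nonneg h.pm_nonneg)

theorem om_le' (h : Sizes K m n k q c w rm cm om bm pm) :
    om ≤ K * (n * k / (w * (q * c))) := by
  obtain ⟨hK, hm, hn, hk, hq, hc, hw, hwq, hq1, hr0, hc0, hb0, hp0, hr, hcm, ho, hb, hp⟩ := h
  refine ho.trans ?_
  rw [mul_assoc q q c]
  gcongr

theorem rm_cm (h : Sizes K m n k q c w rm cm om bm pm) :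
    rm * cm ≤ K ^ 2 * (m * n / q ^ 2) := by
  obtain ⟨hK, hm, hn, hk, hq, hc, hw, hwq, hq1, hr0, hc0, hb0, hp0, hr, hcm, ho, hb, hp⟩ := h
  calc rm * cm ≤ (K * (m / q)) * (K * (n / q)) := by gcongr
    _ = _ := by field_simp

theorem bm_rm_cm (h : Sizes K m n k q c w rm cm om bm pm) :
    bm * (rm * cm) ≤ 2 * K ^ 2 * (m * n * k / (w * (q * q * c))) := by
  calc bm * (rm * cm) ≤ (2 * (k / (w * c))) * (K ^ 2 * (m * n / q ^ 2)) := by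
        have h1 := h.rm_cm
        have h2 := h.bm_le
        have h3 := mul_nonneg h.rm_nonneg h.cm_nonneg
        have h4 := h.bm_nonneg
        have h5 := h4.trans h2
        gcongr
    _ = _ := by
      have := h.q_pos
      have := h.w_pos
      have := h.c_pos
      field_simp

theorem K_le (h : Sizes K m n k q c w rm cm om bm pm) {a : ℝ} (ha : 0 ≤ a) : K * a ≤ K ^ 2 * a :=
  mul_le_mul_of_nonneg_right (by nlinarith [h.one_le]) ha

theorem memory_le (h : Sizes K m n k q c w rm cm om bm pm) :
    rm * cm + om + (cm * (w * pm) + cm * bm + rm * bm + q * (rm * pm) + rm * (w * pm)) ≤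
      6 * K ^ 2 * (m * n / q ^ 2 + (m * k + n * k) / (w * (q * c))) := by
  have hm := h.m_nonneg
  have hn := h.n_nonneg
  have hk := h.k_nonneg
  have hq := h.q_pos
  have hc := h.c_pos
  have hw := h.w_pos
  have hu : 0 ≤ m * k / (w * (q * c)) := by positivity
  have hv : 0 ≤ n * k / (w * (q * c)) := by positivity
  have hD : 0 ≤ K ^ 2 * (m * n / q ^ 2) := by positivity
  rw [add_div]
  have hv' : 0 ≤ K ^ 2 * (n * k / (w * (q * c))) := by positivity
  linarith [h.rm_bm, h.cm_bm, h.q_rm_pm, h.rm_w_pm, h.cm_w_pm, h.om_le', h.rm_cm, h.K_le hu,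
    h.K_le hv]

/-- The block product gives the main term; zeroing and summation contribute only a multiple of the
communication volume, later paid through γ ≤ β. -/
theorem flops_le (h : Sizes K m n k q c w rm cm om bm pm) :
    rm * bm + 2 * bm * (rm * cm) + rm * pm * (q + 1) ≤
      4 * K ^ 2 * (m * n * k / (w * (q * q * c))) + 6 * K * ((m * k + n * k) / (w * (q * c))) := by
  have hn := h.n_nonneg
  have hk := h.k_nonneg
  have hq := h.q_pos
  have hc := h.c_pos
  have hw := h.w_pos
  have hK := h.one_le
  have hv : 0 ≤ K * (n * k / (w * (q * c))) := by positivity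
  rw [add_div]
  linarith [h.rm_bm, h.bm_rm_cm, h.q_rm_pm, h.rm_pm]

theorem words_le (h : Sizes K m n k q c w rm cm om bm pm) :
    (cm * (w * pm) + om) + (cm * bm + q * (cm * pm)) + (q * (rm * pm) + rm * bm) ≤
      7 * K * ((m * k + n * k) / (w * (q * c))) := by
  have hm := h.m_nonneg
  have hk := h.k_nonneg
  have hq := h.q_pos
  have hc := h.c_pos
  have hw := h.w_pos
  have hK := h.one_le
  have hu : 0 ≤ K * (m * k / (w * (q * c))) := by positivity
  rw [add_div]
  linarith [h.rm_bm, h.cm_bm, h.q_rm_pm, h.q_cm_pm, h.cm_w_pm, h.om_le']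

theorem traffic_sum_le (h : Sizes K m n k q c w rm cm om bm pm) :
    rm * pm * (q + 3) ≤ 8 * K * ((m * k + n * k) / (w * (q * c))) := by
  have hn := h.n_nonneg
  have hk := h.k_nonneg
  have hq := h.q_pos
  have hc := h.c_pos
  have hw := h.w_pos
  have hK := h.one_le
  have hv : 0 ≤ K * (n * k / (w * (q * c))) := by positivity
  rw [add_div]
  linarith [h.q_rm_pm, h.rm_pm]

theorem traffic_kept_le (h : Sizes K m n k q c w rm cm om bm pm) :
    3 * (rm * bm) + 14 * (cm * bm) ≤ 28 * K * ((m * k + n * k) / (w * (q * c))) := by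
  have hm := h.m_nonneg
  have hk := h.k_nonneg
  have hq := h.q_pos
  have hc := h.c_pos
  have hw := h.w_pos
  have hK := h.one_le
  have hu : 0 ≤ K * (m * k / (w * (q * c))) := by positivity
  rw [add_div]
  linarith [h.rm_bm, h.cm_bm]

/-- The term `rm * cm` is one pass over the block of `A`. The full strips cost three times the
number of scalar products divided by `s`, and the incomplete ones are of the size of the blocks of
`B` and `C`. -/
theorem traffic_empty_le (h : Sizes K m n k q c w rm cm om bm pm) {s : ℝ} (hs : 0 < s) :
    rm * bm + rm * cm + bm * (cm * (rm / s + 1) + 2 * (rm * (cm / s + 1))) ≤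
      6 * K * ((m * k + n * k) / (w * (q * c))) + K ^ 2 * (m * n / q ^ 2) +
        6 * K ^ 2 * (m * n * k / (w * (q * q * c))) / s := by
  have hm := h.m_nonneg
  have hn := h.n_nonneg
  have hk := h.k_nonneg
  have hq := h.q_pos
  have hc := h.c_pos
  have hw := h.w_pos
  have hK := h.one_le
  have hv : 0 ≤ K * (n * k / (w * (q * c))) := by positivity
  have h1 : bm * (rm * cm) / s ≤ 2 * K ^ 2 * (m * n * k / (w * (q * q * c))) / s :=
    div_le_div_of_nonneg_right h.bm_rm_cm hs.le
  have h2 : rm * bm + rm * cm + bm * (cm * (rm / s + 1) + 2 * (rm * (cm / s + 1))) =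
      3 * (rm * bm) + rm * cm + cm * bm + 3 * (bm * (rm * cm) / s) := by
    field_simp
    ring
  rw [h2, add_div]
  have h3 : 6 * K ^ 2 * (m * n * k / (w * (q * q * c))) / s =
    3 * (2 * K ^ 2 * (m * n * k / (w * (q * q * c))) / s) := by ring
  linarith [h.rm_bm, h.cm_bm, h.rm_cm]

end Sizes

/-- The choice s = ⌊√⌊H/3⌋⌋ gives 3 s² ≤ H, which covers s² + s + 1. Conversely ⌊H/3⌋ < (s + 1)² ≤ 4
s², so H is below 16 s². -/
theorem sqrt_le_four_mul_sqrt {H : ℕ} (hH : 3 ≤ H) :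
    0 < Nat.sqrt (H / 3) ∧ Nat.sqrt (H / 3) * Nat.sqrt (H / 3) + Nat.sqrt (H / 3) + 1 ≤ H ∧
      Real.sqrt H ≤ 4 * Nat.sqrt (H / 3) := by
  have h1 : 0 < Nat.sqrt (H / 3) := Nat.sqrt_pos.2 (by omega)
  set s := Nat.sqrt (H / 3) with hs
  have h2 : s * s ≤ H / 3 := Nat.sqrt_le _
  have h3 : H / 3 < (s + 1) * (s + 1) := Nat.lt_succ_sqrt _
  have h4 : s ≤ s * s := Nat.le_mul_self s
  refine ⟨h1, by omega, ?_⟩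
  refine Real.sqrt_le_iff.2 ⟨by positivity, ?_⟩
  have h5 : H ≤ (4 * s) ^ 2 := by
    have : (s + 1) * (s + 1) ≤ 4 * (s * s) := by nlinarith
    have : (4 * s) ^ 2 = 16 * (s * s) := by ring
    omega
  exact_mod_cast h5

end StreamingMM

/-! ### Programs for warm and for arbitrary caches. -/

namespace StreamingMM

open BSP

section Programs

variable {m n k q c M w H : ℕ} [NeZero q] [NeZero c] [NeZero w] {L : Layout m n k q c M} {K : ℝ}
  {rm cm om : ℕ}

omit [NeZero q] [NeZero c] in
/-- All but three rows can be kept in a cache that holds the block. -/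
theorem exists_kept (L : Layout m n k q c M) (hH : 3 ≤ H)
    (h : ∀ i j, L.rows i * L.cols j ≤ H) :
    ∃ R₀ : Proc q c → Finset (Fin m), ∀ P, R₀ P ⊆ L.rowSet P.1 ∧
      (L.rowSet P.1 \ R₀ P).card ≤ 3 ∧
      (R₀ P = ∅ ∨ (R₀ P).card * L.cols P.2.1 + L.cols P.2.1 + 1 ≤ H) ∧
      (R₀ P).card * L.cols P.2.1 + 1 * 1 + 1 + 1 ≤ H := by
  have key : ∀ P : Proc q c, ∃ R₀ : Finset (Fin m), R₀ ⊆ L.rowSet P.1 ∧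
      (L.rowSet P.1 \ R₀).card ≤ 3 ∧
      (R₀ = ∅ ∨ R₀.card * L.cols P.2.1 + L.cols P.2.1 + 1 ≤ H) ∧
      R₀.card * L.cols P.2.1 + 1 * 1 + 1 + 1 ≤ H := by
    intro P
    -- The subtraction is truncated: with at most three rows nothing is kept, and `3 ≤ H` alone
    -- makes room for 1 × 1 tiles. Otherwise, if there are columns, the three dropped rows free at
    -- least `3 * L.cols P.2.1` words, enough for a column of `B` with an accumulator and for a 1 ×
    -- 1 tile.
    obtain ⟨R₀, hsub, hcard⟩ := Finset.exists_subset_card_eq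
      (s := L.rowSet P.1) (n := L.rows P.1 - 3) (Nat.sub_le _ _)
    have hP := h P.1 P.2.1
    refine ⟨R₀, hsub, ?_, ?_⟩
    · rw [Finset.card_sdiff_of_subset hsub, hcard, L.card_rowSet]
      omega
    · rcases Nat.lt_or_ge 3 (L.rows P.1) with h3 | h3
      · obtain ⟨a, ha⟩ := Nat.exists_eq_add_of_lt h3
        rw [hcard]
        rw [ha] at hP ⊢
        rw [show 3 + a + 1 - 3 = a + 1 by omega]
        rcases Nat.eq_zero_or_pos (L.cols P.2.1) with h0 | h0
        · simp only [h0, mul_zero]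
          omega
        · constructor
          · right
            nlinarith
          · nlinarith
      · have h0 : R₀ = ∅ := by
          rw [← Finset.card_eq_zero, hcard]
          omega
        simp only [h0, Finset.card_empty, zero_mul, true_or, true_and]
        omega
  choose R₀ hR₀ using key
  exact ⟨R₀, hR₀⟩

/-- The coefficient 49 collects 7 for words, 6 for flops paid by γ ≤ β, and 28 + 8 for traffic paid
by ν ≤ β. -/
theorem exists_program_kept
    (ad : Addresses L w (k / (w * c) + 1) (k / (w * c * q) + 1))
    (hsz : Sizes K m n k q c w rm cm om (k / (w * c) + 1 : ℕ) (k / (w * c * q) + 1 : ℕ))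
    (hr : ∀ i, L.rows i ≤ rm) (hc : ∀ j, L.cols j ≤ cm) (ho : ∀ P, L.owned P ≤ om) (hH : 3 ≤ H)
    (h : ∀ i j, L.rows i * L.cols j ≤ H) :
    ∃ prog : Program (Proc q c) M, Executes prog L H w True ∧
      ∀ γ β ν α : ℝ, 0 ≤ γ → 0 ≤ β → 0 ≤ ν → 0 ≤ α → γ ≤ β → ν ≤ β →
        prog.time γ β ν α ≤ 4 * (w * (γ * (4 * K ^ 2 * (m * n * k / (w * (q * q * c)))) +
          β * (49 * K * ((m * k + n * k) / (w * (q * c)))) + α)) := by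
  obtain ⟨R₀, hR₀⟩ := exists_kept L hH h
  refine ⟨ad.program R₀ 1, ad.executes (fun P => (hR₀ P).1) one_pos (fun P => (hR₀ P).2.2.1)
    (fun P => (hR₀ P).2.2.2) (Or.inl trivial), ?_⟩
  intro γ β ν α hγ hβ hν hα hγβ hνβ
  refine (ad.time_program_le (ad.flops_step_le (fun P => (hR₀ P).1) hr hc 1)
    (ad.words_step_le hr hc ho 1)
    (ad.traffic_step_le hr fun P t => trafficOf_multiply_kept_le _ _ _ (hR₀ P).1 (hR₀ P).2.1
      (Nat.le_add_left 1 (k / (w * c))) (card_blockCols_le P.2.2 t) (hr P.1) (hc P.2.1))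
    hγ hβ hν hα).trans ?_
  have h1 := mul_le_mul_of_nonneg_left hsz.flops_le hγ
  have h2 := mul_le_mul_of_nonneg_left hsz.words_le hβ
  have h3 := mul_le_mul_of_nonneg_left (add_le_add hsz.traffic_kept_le hsz.traffic_sum_le) hν
  have hK := hsz.one_le
  have hG : 0 ≤ K * (((m : ℝ) * k + n * k) / (w * (q * c))) := by positivity
  have h4 := mul_le_mul_of_nonneg_right hγβ hG
  have h5 := mul_le_mul_of_nonneg_right hνβ hG
  refine mul_le_mul_of_nonneg_left (mul_le_mul_of_nonneg_left ?_ (Nat.cast_nonneg w)) (by norm_num)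
  push_cast at h1 h2 h3 ⊢
  linarith

/-- The coefficient 28 is 4 for the flops themselves plus 24 for the tiling traffic, which ν ≤ γ √H
≤ 4 γ s converts into flops. -/
theorem exists_program_empty
    (ad : Addresses L w (k / (w * c) + 1) (k / (w * c * q) + 1))
    (hsz : Sizes K m n k q c w rm cm om (k / (w * c) + 1 : ℕ) (k / (w * c * q) + 1 : ℕ))
    (hr : ∀ i, L.rows i ≤ rm) (hc : ∀ j, L.cols j ≤ cm) (ho : ∀ P, L.owned P ≤ om) (hH : 3 ≤ H) :
    ∃ prog : Program (Proc q c) M, Executes prog L H w False ∧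
      ∀ γ β ν α : ℝ, 0 ≤ γ → 0 ≤ β → 0 ≤ ν → 0 ≤ α → γ ≤ β → ν ≤ β → ν ≤ γ * Real.sqrt H →
        prog.time γ β ν α ≤ 4 * (w * (γ * (28 * K ^ 2 * (m * n * k / (w * (q * q * c)))) +
          β * (49 * K * ((m * k + n * k) / (w * (q * c)))) + α +
          ν * (K ^ 2 * (m * n / q ^ 2)))) := by
  obtain ⟨hs, hcap, hsqrt⟩ := sqrt_le_four_mul_sqrt hH
  set s := Nat.sqrt (H / 3) with hs_def
  have hR₀ : ∀ P : Proc q c, (∅ : Finset (Fin m)) ⊆ L.rowSet P.1 := fun P => Finset.empty_subset _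
  refine ⟨ad.program (fun _ => ∅) s, ad.executes hR₀ hs (fun P => Or.inl rfl)
    (fun P => by simpa using hcap) (Or.inr fun _ => rfl), ?_⟩
  intro γ β ν α hγ hβ hν hα hγβ hνβ hνγ
  refine (ad.time_program_le (ad.flops_step_le hR₀ hr hc s) (ad.words_step_le hr hc ho s)
    (ad.traffic_step_le hr fun P t => trafficOf_multiply_empty_le _ _ _
      (card_blockCols_le P.2.2 t) (hr P.1) (hc P.2.1)) hγ hβ hν hα).trans ?_
  have hs' : (0 : ℝ) < s := by exact_mod_cast hs
  have hQ : ((rm * (k / (w * c) + 1) + rm * cm + (k / (w * c) + 1) *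
      (cm * (rm / s + 1) + 2 * (rm * (cm / s + 1))) : ℕ) : ℝ) ≤
      6 * K * ((m * k + n * k) / (w * (q * c))) + K ^ 2 * (m * n / q ^ 2) +
        6 * K ^ 2 * (m * n * k / (w * (q * q * c))) / s := by
    refine le_trans ?_ (hsz.traffic_empty_le hs')
    have h1 : ((rm / s : ℕ) : ℝ) ≤ rm / s := Nat.cast_div_le
    have h2 : ((cm / s : ℕ) : ℝ) ≤ cm / s := Nat.cast_div_le
    rw [Nat.cast_add, Nat.cast_add, Nat.cast_mul, Nat.cast_mul, Nat.cast_mul]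
    rw [Nat.cast_add (cm * (rm / s + 1)), Nat.cast_mul cm, Nat.cast_add (rm / s), Nat.cast_mul 2,
      Nat.cast_mul rm, Nat.cast_add (cm / s)]
    push_cast
    gcongr
  have h1 := mul_le_mul_of_nonneg_left hsz.flops_le hγ
  have h2 := mul_le_mul_of_nonneg_left hsz.words_le hβ
  have h3 := mul_le_mul_of_nonneg_left (add_le_add hQ hsz.traffic_sum_le) hν
  have hK := hsz.one_le
  have hG : 0 ≤ K * (((m : ℝ) * k + n * k) / (w * (q * c))) := by positivity
  have h4 := mul_le_mul_of_nonneg_right hγβ hG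
  have h5 := mul_le_mul_of_nonneg_right hνβ hG
  have h6 : ν * (6 * K ^ 2 * (m * n * k / (w * (q * q * c))) / s) ≤
      γ * (24 * K ^ 2 * (m * n * k / (w * (q * q * c)))) := by
    have h7 : ν ≤ γ * (4 * s) := hνγ.trans (mul_le_mul_of_nonneg_left hsqrt hγ)
    calc _ ≤ γ * (4 * s) * (6 * K ^ 2 * (m * n * k / (w * (q * q * c))) / s) := by gcongr
      _ = _ := by
        field_simp
        ring
  -- The coefficient of β needed here is only 7 + 6 + 6 + 8; nonnegativity covers the excess up to
  -- 49.
  have hG' : 0 ≤ β * (K * (((m : ℝ) * k + n * k) / (w * (q * c)))) := mul_nonneg hβ hG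
  refine mul_le_mul_of_nonneg_left (mul_le_mul_of_nonneg_left ?_ (Nat.cast_nonneg w)) (by norm_num)
  rw [Nat.cast_add (rm * (k / (w * c) + 1) + rm * cm + (k / (w * c) + 1) *
      (cm * (rm / s + 1) + 2 * (rm * (cm / s + 1))))]
  push_cast at h1 h2 h3 ⊢
  linarith

end Programs

end StreamingMM

/-! ### The main theorem: translation to powers of p and choice of the constant. -/

theorem mainTheorem6 (K : ℝ) :
    ∃ C : ℝ, 0 < C ∧
      ∀ (p m n k w q c H M : ℕ) (δ : ℝ),
        0 < p → p ≤ m → p ≤ n → p ≤ k →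
        1 / 2 ≤ δ → δ ≤ 2 / 3 →
        (q : ℝ) = (p : ℝ) ^ (1 - δ) → (c : ℝ) = (p : ℝ) ^ (2 * δ - 1) →
        1 ≤ w → w ≤ q → 3 ≤ H →
        C * ((m : ℝ) * n / (p : ℝ) ^ (2 * (1 - δ)) +
          ((m : ℝ) * k + (n : ℝ) * k) / (w * (p : ℝ) ^ δ)) ≤ M →
        ∀ L : StreamingMM.Layout m n k q c M,
          (∀ i, (L.rows i : ℝ) ≤ K * (m / (p : ℝ) ^ (1 - δ))) →
          (∀ j, (L.cols j : ℝ) ≤ K * (n / (p : ℝ) ^ (1 - δ))) →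
          (∀ P, (L.owned P : ℝ) ≤ K * ((n : ℝ) * k / p)) →
          ((∀ i j, L.rows i * L.cols j ≤ H) →
            ∃ prog : BSP.Program (StreamingMM.Proc q c) M,
              StreamingMM.Executes prog L H w True ∧
              ∀ γ β ν α : ℝ, 0 ≤ γ → 0 ≤ β → 0 ≤ ν → 0 ≤ α →
                γ ≤ β → ν ≤ β → ν ≤ γ * Real.sqrt H →
                prog.time γ β ν α ≤
                  C * (γ * ((m : ℝ) * n * k / p) +
                    β * (((m : ℝ) * k + (n : ℝ) * k) / (p : ℝ) ^ δ) + α * w)) ∧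
          (∃ prog : BSP.Program (StreamingMM.Proc q c) M,
            StreamingMM.Executes prog L H w False ∧
            ∀ γ β ν α : ℝ, 0 ≤ γ → 0 ≤ β → 0 ≤ ν → 0 ≤ α →
              γ ≤ β → ν ≤ β → ν ≤ γ * Real.sqrt H →
              prog.time γ β ν α ≤
                C * (γ * ((m : ℝ) * n * k / p) +
                  β * (((m : ℝ) * k + (n : ℝ) * k) / (p : ℝ) ^ δ) + α * w +
                  ν * ((w : ℝ) * m * n / (p : ℝ) ^ (2 * (1 - δ))))) := by
  have hK : 1 ≤ max K 1 := le_max_right _ _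
  have hKK : K ≤ max K 1 := le_max_left _ _
  set K' := max K 1 with hK'
  have hKsq : K' ≤ K' ^ 2 := by nlinarith
  -- The largest coefficient that occurs is 4 * 49 = 196. Replacing `K` by `max K 1` gives `K' ≤ K'
  -- ^ 2`, so one power of `K'` serves all terms.
  refine ⟨200 * K' ^ 2, by positivity, ?_⟩
  intro p m n k w q c H M δ hp hpm hpn hpk _ _ hq hc hw hwq hH hM L hrows hcols howned
  have hp' : (0 : ℝ) < p := by exact_mod_cast hp
  have hqpos : (0 : ℝ) < q := hq ▸ Real.rpow_pos_of_pos hp' _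
  have hcpos : (0 : ℝ) < c := hc ▸ Real.rpow_pos_of_pos hp' _
  have hwpos : (0 : ℝ) < w := by exact_mod_cast hw
  have hmpos : (0 : ℝ) < m := by exact_mod_cast hp.trans_le hpm
  have hnpos : (0 : ℝ) < n := by exact_mod_cast hp.trans_le hpn
  have hkpos : (0 : ℝ) < k := by exact_mod_cast hp.trans_le hpk
  have e1 : (p : ℝ) ^ δ = q * c := by
    rw [hq, hc, ← Real.rpow_add hp']
    congr 1
    ring
  have e2 : (p : ℝ) ^ (2 * (1 - δ)) = (q : ℝ) ^ 2 := by
    rw [hq, sq, ← Real.rpow_add hp']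
    congr 1
    ring
  have e3 : (p : ℝ) = q * q * c := by
    rw [mul_assoc, ← e1, hq, ← Real.rpow_add hp', sub_add_cancel, Real.rpow_one]
  have e3' : p = q * q * c := by exact_mod_cast e3
  have : NeZero q := ⟨by rintro rfl; simp at hqpos⟩
  have : NeZero c := ⟨by rintro rfl; simp at hcpos⟩
  have : NeZero w := ⟨by omega⟩
  have hq1 : 1 ≤ q := Nat.one_le_iff_ne_zero.2 (NeZero.ne q)
  have hc1 : 1 ≤ c := Nat.one_le_iff_ne_zero.2 (NeZero.ne c)
  -- A piece has at least one column on average, as w c q ≤ q² c = p ≤ k; this is what bounds the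
  -- rounding.
  have hpiece : w * c * q ≤ k := by
    refine le_trans ?_ hpk
    rw [e3']
    calc w * c * q ≤ q * c * q := by gcongr
      _ = _ := by ring
  have hblock : w * c ≤ k := (Nat.le_mul_of_pos_right _ hq1).trans hpiece
  rw [← hq] at hrows hcols
  rw [e1, e2] at hM
  simp only [e1, e2]
  rw [e3] at howned ⊢
  -- Floors turn the real bounds into natural ones, as needed for counting addresses and costs.
  have hrows' : ∀ i, L.rows i ≤ ⌊K' * (m / (q : ℝ))⌋₊ := fun i => Nat.le_floor
    ((hrows i).trans (mul_le_mul_of_nonneg_right hKK (by positivity)))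
  have hcols' : ∀ j, L.cols j ≤ ⌊K' * (n / (q : ℝ))⌋₊ := fun i => Nat.le_floor
    ((hcols i).trans (mul_le_mul_of_nonneg_right hKK (by positivity)))
  have howned' : ∀ P, L.owned P ≤ ⌊K' * ((n : ℝ) * k / (q * q * c))⌋₊ := fun P => Nat.le_floor
    ((howned P).trans (mul_le_mul_of_nonneg_right hKK (by positivity)))
  set rm := ⌊K' * (m / (q : ℝ))⌋₊ with hrm
  set cm := ⌊K' * (n / (q : ℝ))⌋₊ with hcm
  set om := ⌊K' * ((n : ℝ) * k / (q * q * c))⌋₊ with hom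
  have hsz : StreamingMM.Sizes K' m n k q c w rm cm om (k / (w * c) + 1 : ℕ)
      (k / (w * c * q) + 1 : ℕ) := by
    refine ⟨hK, hmpos.le, hnpos.le, hkpos.le, hqpos, hcpos, hwpos, by exact_mod_cast hwq,
      by exact_mod_cast hq1, Nat.cast_nonneg _, Nat.cast_nonneg _, Nat.cast_nonneg _,
      Nat.cast_nonneg _, Nat.floor_le (by positivity), Nat.floor_le (by positivity),
      Nat.floor_le (by positivity), ?_, ?_⟩
    · have := StreamingMM.cast_div_add_one_le (Nat.mul_pos hw hc1) hblock
      rwa [Nat.cast_mul w c] at this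
    · have := StreamingMM.cast_div_add_one_le (Nat.mul_pos (Nat.mul_pos hw hc1) hq1) hpiece
      rwa [Nat.cast_mul (w * c) q, Nat.cast_mul w c] at this
  have hDpos : 0 < (m : ℝ) * n / (q : ℝ) ^ 2 +
      ((m : ℝ) * k + (n : ℝ) * k) / (w * (q * c)) := by positivity
  -- The lower bound on the memory is positive, so there is an address to serve as the dummy value
  -- in `Addresses.nonempty`.
  have : NeZero M := ⟨by
    rintro rfl
    have : 0 < 200 * K' ^ 2 * ((m : ℝ) * n / (q : ℝ) ^ 2 +
      ((m : ℝ) * k + (n : ℝ) * k) / (w * (q * c))) := by positivity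
    rw [Nat.cast_zero] at hM
    linarith⟩
  obtain ⟨ad⟩ := StreamingMM.Addresses.nonempty L w (k / (w * c) + 1) (k / (w * c * q) + 1) <| by
    intro P
    have h1 : rm * cm + om + (cm * (w * (k / (w * c * q) + 1)) + cm * (k / (w * c) + 1) +
        rm * (k / (w * c) + 1) + q * (rm * (k / (w * c * q) + 1)) +
        rm * (w * (k / (w * c * q) + 1))) ≤ M := by
      have h2 := hsz.memory_le
      have h3 : 6 * K' ^ 2 * ((m : ℝ) * n / (q : ℝ) ^ 2 +
          ((m : ℝ) * k + (n : ℝ) * k) / (w * (q * c))) ≤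
          200 * K' ^ 2 * ((m : ℝ) * n / (q : ℝ) ^ 2 +
          ((m : ℝ) * k + (n : ℝ) * k) / (w * (q * c))) := by
        gcongr
        norm_num
      exact_mod_cast (h2.trans h3).trans hM
    refine le_trans ?_ h1
    have := hrows' P.1
    have := hcols' P.2.1
    have := howned' P
    gcongr
  have hN0 : 0 ≤ (m : ℝ) * n * k / (q * q * c) := by positivity
  have hG0 : 0 ≤ ((m : ℝ) * k + n * k) / (q * c) := by positivity
  have hN : w * ((m : ℝ) * n * k / (w * (q * q * c))) = (m : ℝ) * n * k / (q * q * c) := by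
    field_simp
  have hG : w * (((m : ℝ) * k + n * k) / (w * (q * c))) = ((m : ℝ) * k + n * k) / (q * c) := by
    field_simp
  have hKK2 : 1 ≤ K' ^ 2 := hK.trans hKsq
  refine ⟨fun hcache => ?_, ?_⟩
  · obtain ⟨prog, hprog, htime⟩ :=
      StreamingMM.exists_program_kept ad hsz hrows' hcols' howned' hH hcache
    refine ⟨prog, hprog, fun γ β ν α hγ hβ hν hα hγβ hνβ _ => ?_⟩
    refine (htime γ β ν α hγ hβ hν hα hγβ hνβ).trans ?_
    have h1 : 0 ≤ γ * ((m : ℝ) * n * k / (q * q * c)) := by positivity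
    have h2 : 0 ≤ β * (((m : ℝ) * k + n * k) / (q * c)) := by positivity
    have h3 : 0 ≤ α * w := by positivity
    calc _ = 16 * K' ^ 2 * (γ * (w * ((m : ℝ) * n * k / (w * (q * q * c))))) +
          196 * K' * (β * (w * (((m : ℝ) * k + n * k) / (w * (q * c))))) + 4 * (α * w) := by ring
      _ ≤ 200 * K' ^ 2 * (γ * ((m : ℝ) * n * k / (q * q * c))) +
          200 * K' ^ 2 * (β * (((m : ℝ) * k + n * k) / (q * c))) +
          200 * K' ^ 2 * (α * w) := by
        rw [hN, hG]
        gcongr <;> linarith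
      _ = _ := by ring
  · obtain ⟨prog, hprog, htime⟩ :=
      StreamingMM.exists_program_empty ad hsz hrows' hcols' howned' hH
    refine ⟨prog, hprog, fun γ β ν α hγ hβ hν hα hγβ hνβ hνγ => ?_⟩
    refine (htime γ β ν α hγ hβ hν hα hγβ hνβ hνγ).trans ?_
    have h1 : 0 ≤ γ * ((m : ℝ) * n * k / (q * q * c)) := by positivity
    have h2 : 0 ≤ β * (((m : ℝ) * k + n * k) / (q * c)) := by positivity
    have h3 : 0 ≤ α * w := by positivity
    have h4 : 0 ≤ ν * ((w : ℝ) * m * n / q ^ 2) := by positivity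
    calc _ = 112 * K' ^ 2 * (γ * (w * ((m : ℝ) * n * k / (w * (q * q * c))))) +
          196 * K' * (β * (w * (((m : ℝ) * k + n * k) / (w * (q * c))))) + 4 * (α * w) +
          4 * K' ^ 2 * (ν * ((w : ℝ) * m * n / q ^ 2)) := by ring
      _ ≤ 200 * K' ^ 2 * (γ * ((m : ℝ) * n * k / (q * q * c))) +
          200 * K' ^ 2 * (β * (((m : ℝ) * k + n * k) / (q * c))) +
          200 * K' ^ 2 * (α * w) + 200 * K' ^ 2 * (ν * ((w : ℝ) * m * n / q ^ 2)) := by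
        rw [hN, hG]
        gcongr <;> linarith
      _ = _ := by ring
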